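/- Let $d,q\ge 1$ be integers, $\nu>0$, $0<t\le T$, $\mathbf x\in\mathbb R^d$, and let $\mathbf H=(H_0,\dots,H_d)\in(1/2,1)^{d+1}$ satisfy $$2H_0+\sum_{i=1}^d H_i>d+1-\frac1q .$$ Let $W$ be a Gaussian white noise on $\mathbb R^{d+1}$ over a probability space $(\Omega,\mathcal F,\mathbb P)$ and let $I_q$ be the multiple Wiener–Itô integral of order $q$. For a deterministic function $\Phi$ on $[0,\infty)\times\mathbb R^d$ (extended by $0$) put $$F_\Phi(\mathbf y_1,\dots,\mathbf y_q)=c(\mathbf H,q)\int_{\mathbb R^{d+1}}\Phi(a)\prod_{j=1}^q\prod_{i=0}^d(a_i-y_{j,i})_+^{-(1/2+(1-H_i)/q)}\,da ,\qquad \int\Phi\,dZ^{q,\mathbf H}=I_q(F_\Phi),$$ which is meaningful when the inner integral converges absolutely for almost every $(\mathbf y_1,\dots,\mathbf y_q)$ and $F_\Phi\in L^2((\mathbb R^{d+1})^q)$. The Hermite noise is $Z^{q,\mathbf H}(B)=\int\mathbf 1_B\,dZ^{q,\mathbf H}$ for bounded Borel $B\subset[0,\infty)\times\mathbb R^d$,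 and $c(\mathbf H,q)>0$ is fixed by $\mathbb E[Z^{q,\mathbf H}([0,1]^{d+1})^2]=1$. Let $(\mathcal F_s)_{s\ge0}$ be the filtration generated by this noise, augmented by the null sets. For $m\ge 1$, a measurable function $\Psi$ on $([0,T]\times\mathbb R^d)^m$ belongs to $\mathcal H^{\otimes m}$ if the integral $$\|\Psi\|^2_{\mathcal H^{\otimes m}}=\alpha_{\mathbf H}^m\int\!\!\int\Psi(a_1,\dots,a_m)\Psi(b_1,\dots,b_m)\prod_{j=1}^m\prod_{i=0}^d|a_{j,i}-b_{j,i}|^{2H_i-2}\,da\,db,\qquad \alpha_{\mathbf H}=\prod_{i=0}^dH_i(2H_i-1),$$ over $([0,T]\times\mathbb R^d)^m\times([0,T]\times\mathbb R^d)^m$ converges absolutely. A function $f$ on $[0,T]\times\mathbb R^d$ is regarded as an element of $\mathcal H^{\otimes m}$ through $f^{\otimes m}$. Let $\sigma:[0,T]\times\mathbb R^d\times\mathbb R\to\mathbb R$ be measurable with $|\sigma(s,\mathbf y,v)-\sigma(s,\mathbf y,w)|\le L|v-w|$ for all $s,\mathbf y,v,w$ and some $L>0$, and, for some $p\ge2$,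 $\sup_{s,\mathbf y}\mathbb E[|\sigma(s,\mathbf y,0)|^p]<\infty$. Let $u$ be a random field, predictable with respect to $(\mathcal F_s)$, with $\sup_{s\in[0,T],\,\mathbf y}\mathbb E[|u(s,\mathbf y)|^p]<\infty$. With $G_r(\mathbf z)=(4\pi\nu r)^{-d/2}e^{-|\mathbf z|^2/(4\nu r)}$ put $$f(s,\mathbf y)=G_{t-s}(\mathbf x-\mathbf y)\,\sigma(s,\mathbf y,u(s,\mathbf y))\,\mathbf 1_{\{0\le s<t\}} .$$ Then: 1. Almost surely $f\in\mathcal H$ and $f\in\mathcal H^{\otimes q}$. 2. $\mathbb E\big[\|f\|_{\mathcal H}^2\big]<\infty$; if $p\ge 2q$, then also $\mathbb E\big[\|f^{\otimes q}\|_{\mathcal H^{\otimes q}}^2\big]<\infty$. 3. The stochastic convolution $\int_0^t\int_{\mathbb R^d}G_{t-s}(\mathbf x-\mathbf y)\sigma(s,\mathbf y,u(s,\mathbf y))\,Z^{q,\mathbf H}(ds,d\mathbf y)$ is well defined in the following sense. (a) For $\mathbb P$-almost every $\omega$, the integral $\int f(\omega,\cdot)\,dZ^{q,\mathbf H}=I_q(F_{f(\omega,\cdot)})$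 of the path $f(\omega,\cdot)$, taken as a deterministic integrand, exists in $L^2(\Omega)$ and is unique up to null sets. (b) The random kernel $F(\omega,\cdot)=F_{f(\omega,\cdot)}$ lies in $L^2(\Omega\times(\mathbb R^{d+1})^q)$, and its multiple Skorohod integral is defined by duality: there is a constant $C$ such that for all smooth cylindrical $G=g(W(A_1),\dots,W(A_n))$, where $A_1,\dots,A_n$ are bounded Borel sets and $g$ is smooth with all derivatives of polynomial growth, the $q$-th Malliavin derivative $D^qG$ is in $L^2(\Omega\times(\mathbb R^{d+1})^q)$ and $\big|\mathbb E\langle F,D^qG\rangle\big|\le C\,\big(\mathbb E\|D^qG\|^2\big)^{1/2}$, where $\langle\cdot,\cdot\rangle$ and $\|\cdot\|$ are those of $L^2((\mathbb R^{d+1})^q)$. -/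

import Mathlib

open MeasureTheory ProbabilityTheory Filter Topology
open scoped NNReal ENNReal Nat

/-- Space-time `ℝ^{d+1}`: coordinate `0` is time, the other `d` coordinates are space. -/
abbrev SpaceTime (d : ℕ) : Type := Fin (d + 1) → ℝ

/-- The bounded Borel subsets of `ℝ^{d+1}`. -/
def BddBorel {d : ℕ} (A : Set (SpaceTime d)) : Prop :=
  MeasurableSet A ∧ Bornology.IsBounded A

/-- Gaussian white noise on `ℝ^{d+1}`: a centred Gaussian process indexed by the bounded Borel
sets with `E[W(A) W(B)] = λ(A ∩ B)`. -/
structure IsWhiteNoise {d : ℕ} {Ω : Type*} [MeasurableSpace Ω] (P : Measure Ω)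
    (W : Set (SpaceTime d) → Ω → ℝ) : Prop where
  measurable : ∀ A, BddBorel A → Measurable (W A)
  gaussian : IsGaussianProcess (fun A : {A : Set (SpaceTime d) // BddBorel A} => W A.1) P
  mean : ∀ A, BddBorel A → ∫ ω, W A ω ∂P = 0
  cov : ∀ A B, BddBorel A → BddBorel B →
    ∫ ω, W A ω * W B ω ∂P = (volume (A ∩ B)).toReal

/-- Elementary symmetric kernels `∑ a_{i₁…i_q} 1_{A_{i₁} × ⋯ × A_{i_q}}` with disjoint `A_j` and
coefficients vanishing when two indices are equal. -/
structure ElementaryKernel (d q : ℕ) where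
  n : ℕ
  A : Fin n → Set (SpaceTime d)
  coeff : (Fin q → Fin n) → ℝ
  bddBorel : ∀ k, BddBorel (A k)
  disjoint : ∀ k l, k ≠ l → Disjoint (A k) (A l)
  diag : ∀ i, ¬ Function.Injective i → coeff i = 0
  symm : ∀ (i : Fin q → Fin n) (π : Equiv.Perm (Fin q)), coeff (i ∘ π) = coeff i

/-- The function on `(ℝ^{d+1})^q` given by an elementary kernel. -/
noncomputable def ElementaryKernel.toFun {d q : ℕ} (e : ElementaryKernel d q)
    (y : Fin q → SpaceTime d) : ℝ :=
  ∑ i : Fin q → Fin e.n, e.coeff i * ∏ j, (e.A (i j)).indicator 1 (y j)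

/-- `I_q` of an elementary kernel: `∑ a_{i₁…i_q} W(A_{i₁}) ⋯ W(A_{i_q})`. -/
noncomputable def ElementaryKernel.integral {d q : ℕ} (e : ElementaryKernel d q) {Ω : Type*}
    (W : Set (SpaceTime d) → Ω → ℝ) (ω : Ω) : ℝ :=
  ∑ i : Fin q → Fin e.n, e.coeff i * ∏ j, W (e.A (i j)) ω

/-- `X = I_q(F)`: the multiple Wiener–Itô integral of order `q` of `F ∈ L²((ℝ^{d+1})^q)`, i.e. the
`L²(Ω)`-limit of `I_q(e_n)` along elementary symmetric kernels `e_n → F` in `L²`. -/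
def IsMultipleIntegral {d q : ℕ} {Ω : Type*} [MeasurableSpace Ω] (P : Measure Ω)
    (W : Set (SpaceTime d) → Ω → ℝ) (F : (Fin q → SpaceTime d) → ℝ) (X : Ω → ℝ) : Prop :=
  MemLp F 2 volume ∧ MemLp X 2 P ∧
  ∃ e : ℕ → ElementaryKernel d q,
    Tendsto (fun n => eLpNorm (fun y => F y - (e n).toFun y) 2 volume) atTop (𝓝 0) ∧
    Tendsto (fun n => eLpNorm (fun ω => X ω - (e n).integral W ω) 2 P) atTop (𝓝 0)

/-- `K^H(a; y₁,…,y_q) = ∏_j ∏_i (a_i - y_{j,i})_+^{-(1/2 + (1-H_i)/q)}`; in `Real.rpow`,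
`0` to a nonzero power is `0`, so that the kernel vanishes unless all `y_{j,i} < a_i`. -/
noncomputable def fracKernel {d : ℕ} (q : ℕ) (H : Fin (d + 1) → ℝ) (a : SpaceTime d)
    (y : Fin q → SpaceTime d) : ℝ :=
  ∏ j, ∏ i, (max (a i - y j i) 0) ^ (-(1 / 2 + (1 - H i) / (q : ℝ)))

/-- `c ∫ Φ(a) K^H(a; y₁,…,y_q) da`, the kernel of the integral of `Φ` against the Hermite noise. -/
noncomputable def transferKernel {d : ℕ} (q : ℕ) (H : Fin (d + 1) → ℝ) (c : ℝ)
    (Φ : SpaceTime d → ℝ) (y : Fin q → SpaceTime d) : ℝ :=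
  c * ∫ a, Φ a * fracKernel q H a y

/-- `X = ∫ Φ dZ^{q,H}` for a deterministic function `Φ` (extended by `0` to space-time): the
kernel is defined almost everywhere by an absolutely convergent integral, lies in
`L²((ℝ^{d+1})^q)`, and `X` is its multiple Wiener–Itô integral. -/
def IsHermiteIntegral {d : ℕ} {Ω : Type*} [MeasurableSpace Ω] (P : Measure Ω)
    (W : Set (SpaceTime d) → Ω → ℝ) (q : ℕ) (H : Fin (d + 1) → ℝ) (c : ℝ)
    (Φ : SpaceTime d → ℝ) (X : Ω → ℝ) : Prop :=
  (∀ᵐ y : Fin q → SpaceTime d, Integrable (fun a => Φ a * fracKernel q H a y)) ∧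
  IsMultipleIntegral P W (transferKernel q H c Φ) X

/-- Bounded Borel subsets of `[0,∞) × ℝ^d`. -/
def NoiseSet {d : ℕ} (B : Set (SpaceTime d)) : Prop :=
  BddBorel B ∧ ∀ a ∈ B, 0 ≤ a 0

/-- The Hermite noise `Z^{q,H}(B) = ∫ 1_B dZ^{q,H}` of order `q`, built on the white noise `W`;
`Z [0,𝐭]` is the Hermite sheet at `𝐭`, and the constant `c > 0` is fixed by
`E[Z([0,1]^{d+1})²] = 1`. -/
structure IsHermiteNoise {d : ℕ} {Ω : Type*} [MeasurableSpace Ω] (P : Measure Ω)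
    (W : Set (SpaceTime d) → Ω → ℝ) (q : ℕ) (H : Fin (d + 1) → ℝ) (c : ℝ)
    (Z : Set (SpaceTime d) → Ω → ℝ) : Prop where
  measurable : ∀ B, NoiseSet B → Measurable (Z B)
  integral : ∀ B, NoiseSet B → IsHermiteIntegral P W q H c (B.indicator 1) (Z B)
  c_pos : 0 < c
  normalized : ∫ ω, (Z (Set.Icc 0 1) ω) ^ 2 ∂P = 1

/-- The filtration generated by the Hermite noise, augmented by the null sets: at time `t` it is
generated by the events `{Z(B) ∈ V}`, `B ⊆ [0,t] × ℝ^d` bounded Borel, `V ⊆ ℝ` Borel. -/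
def hermiteFiltration {d : ℕ} {Ω : Type*} [mΩ : MeasurableSpace Ω] (P : Measure Ω)
    (Z : Set (SpaceTime d) → Ω → ℝ) (hZ : ∀ B, NoiseSet B → Measurable (Z B)) :
    Filtration ℝ≥0 mΩ where
  seq t := MeasurableSpace.generateFrom
    ({S | ∃ (B : Set (SpaceTime d)) (V : Set ℝ), NoiseSet B ∧ (∀ a ∈ B, a 0 ≤ (t : ℝ)) ∧
      MeasurableSet V ∧ S = Z B ⁻¹' V} ∪ {N | MeasurableSet N ∧ P N = 0})
  mono' := by
    intro s t hst
    refine MeasurableSpace.generateFrom_mono (Set.union_subset_union_left _ ?_)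
    rintro S ⟨B, V, hB, hBs, hV, hS⟩
    exact ⟨B, V, hB, fun a ha => (hBs a ha).trans (NNReal.coe_le_coe.2 hst), hV, hS⟩
  le' := by
    intro t
    refine MeasurableSpace.generateFrom_le ?_
    rintro S (⟨B, V, hB, -, hV, rfl⟩ | hN)
    · exact hZ B hB hV
    · exact hN.1

/-- A random field `u(s,y)`, `s ≥ 0`, `y ∈ ℝ^d`, is predictable: measurable for the product of the
predictable `σ`-algebra on `[0,∞) × Ω` and the Borel `σ`-algebra of `ℝ^d`. -/
def IsPredictableField {d : ℕ} {Ω : Type*} [mΩ : MeasurableSpace Ω] (𝓕 : Filtration ℝ≥0 mΩ)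
    (u : ℝ → (Fin d → ℝ) → Ω → ℝ) : Prop :=
  Measurable[@Prod.instMeasurableSpace _ _ 𝓕.predictable MeasurableSpace.pi]
    (fun p : (ℝ≥0 × Ω) × (Fin d → ℝ) => u p.1.1 p.2 p.1.2)

/-- `sup_{s ∈ [0,T], y} E[|v(s,y)|^p]`, as an extended nonnegative number. -/
noncomputable def momentSup {d : ℕ} {Ω : Type*} [MeasurableSpace Ω] (P : Measure Ω) (T p : ℝ)
    (v : ℝ → (Fin d → ℝ) → Ω → ℝ) : ℝ≥0∞ :=
  ⨆ s ∈ Set.Icc 0 T, ⨆ y : Fin d → ℝ, ∫⁻ ω, ENNReal.ofReal (|v s y ω| ^ p) ∂P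

/-- The heat kernel `G_t(x) = (4πνt)^{-d/2} exp(-|x|²/(4νt))`. -/
noncomputable def heatKernel {d : ℕ} (ν t : ℝ) (x : Fin d → ℝ) : ℝ :=
  (4 * Real.pi * ν * t) ^ (-((d : ℝ) / 2)) * Real.exp (-(∑ i, x i ^ 2) / (4 * ν * t))

open Classical in
/-- The path `(s,y) ↦ G_{t-s}(x-y) σ(s,y,u(s,y)) 1_{s<t}` at `ω`, extended by `0` to `s < 0`. -/
noncomputable def convIntegrand {d : ℕ} {Ω : Type*} (ν : ℝ) (σ : ℝ → (Fin d → ℝ) → ℝ → ℝ)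
    (u : ℝ → (Fin d → ℝ) → Ω → ℝ) (t : ℝ) (x : Fin d → ℝ) (ω : Ω) (a : SpaceTime d) : ℝ :=
  if 0 ≤ a 0 ∧ a 0 < t then
    heatKernel ν (t - a 0) (x - Fin.tail a) *
      σ (a 0) (Fin.tail a) (u (a 0) (Fin.tail a) ω)
  else 0

/-- Lebesgue measure on `([0,T] × ℝ^d)^q`. -/
noncomputable def slabMeasure (d q : ℕ) (T : ℝ) : Measure (Fin q → SpaceTime d) :=
  Measure.pi fun _ => (volume : Measure (SpaceTime d)).restrict {a | a 0 ∈ Set.Icc 0 T}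

/-- The covariance density `α_H ∏_i |a_i - b_i|^{2H_i-2}`, with `α_H = ∏_i H_i (2H_i - 1)`. -/
noncomputable def covKernel {d : ℕ} (H : Fin (d + 1) → ℝ) (a b : SpaceTime d) : ℝ :=
  (∏ i, H i * (2 * H i - 1)) * ∏ i, |a i - b i| ^ (2 * H i - 2)

/-- `Ψ(𝐚) Ψ(𝐛) ∏_j (covariance density at (a_j,b_j))`, the integrand of the squared norm of `Ψ` in
`𝓗^{⊗q}`. -/
noncomputable def tensorDensity {d q : ℕ} (H : Fin (d + 1) → ℝ) (Ψ : (Fin q → SpaceTime d) → ℝ)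
    (z : (Fin q → SpaceTime d) × (Fin q → SpaceTime d)) : ℝ :=
  Ψ z.1 * Ψ z.2 * ∏ j, covKernel H (z.1 j) (z.2 j)

/-- The function `Ψ` on `([0,T] × ℝ^d)^q` belongs to `𝓗^{⊗q}`: it is measurable and the integral
that defines its squared norm converges absolutely. The case `q = 1` is `𝓗` itself. -/
def MemTensor {d q : ℕ} (H : Fin (d + 1) → ℝ) (T : ℝ) (Ψ : (Fin q → SpaceTime d) → ℝ) : Prop :=
  AEStronglyMeasurable Ψ (slabMeasure d q T) ∧
  Integrable (tensorDensity H Ψ) ((slabMeasure d q T).prod (slabMeasure d q T))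

/-- The squared norm of `Ψ` in `𝓗^{⊗q}`. -/
noncomputable def tensorNormSq {d q : ℕ} (H : Fin (d + 1) → ℝ) (T : ℝ)
    (Ψ : (Fin q → SpaceTime d) → ℝ) : ℝ :=
  ∫ z, tensorDensity H Ψ z ∂((slabMeasure d q T).prod (slabMeasure d q T))

/-- The `q`-fold tensor power `f^{⊗q}` of a function `f` on space-time. -/
noncomputable def tensorPow {d : ℕ} (q : ℕ) (f : SpaceTime d → ℝ) (z : Fin q → SpaceTime d) : ℝ :=
  ∏ j, f (z j)

/-- The `q`-th Malliavin derivative of `G = g(W(A_1),…,W(A_n))` at `ω`,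
`∑_i (∂_{i₁} ⋯ ∂_{i_q} g)(W(A_1),…,W(A_n)) 1_{A_{i₁}}(y₁) ⋯ 1_{A_{i_q}}(y_q)`, written through the
multilinear form `D^q g`. -/
noncomputable def malliavinDeriv {d n : ℕ} (q : ℕ) {Ω : Type*} (W : Set (SpaceTime d) → Ω → ℝ)
    (A : Fin n → Set (SpaceTime d)) (g : (Fin n → ℝ) → ℝ) (z : Ω × (Fin q → SpaceTime d)) : ℝ :=
  iteratedFDeriv ℝ q g (fun k => W (A k) z.1) (fun j k => (A k).indicator 1 (z.2 j))

/-- The multiple Skorohod integral `δ^q F` of the random kernel `F ∈ L²(Ω × (ℝ^{d+1})^q)` is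
defined as a generalized random variable: the duality pairing `G ↦ E⟨F, D^q G⟩` is a bounded
functional of the smooth cylindrical random variables `G = g(W(A_1),…,W(A_n))`, `g` smooth with
derivatives of polynomial growth. -/
def HasSkorohodPairing {d q : ℕ} {Ω : Type*} [MeasurableSpace Ω] (P : Measure Ω)
    (W : Set (SpaceTime d) → Ω → ℝ) (F : Ω × (Fin q → SpaceTime d) → ℝ) : Prop :=
  MemLp F 2 (P.prod volume) ∧
  ∃ C : ℝ, ∀ (n : ℕ) (A : Fin n → Set (SpaceTime d)) (g : (Fin n → ℝ) → ℝ),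
    (∀ k, BddBorel (A k)) → Function.HasTemperateGrowth g →
      MemLp (malliavinDeriv q W A g) 2 (P.prod volume) ∧
      Integrable (fun z => F z * malliavinDeriv q W A g z) (P.prod volume) ∧
      |∫ z, F z * malliavinDeriv q W A g z ∂(P.prod volume)| ≤
        C * Real.sqrt (∫ z, malliavinDeriv q W A g z ^ 2 ∂(P.prod volume))

/-!
Everything is controlled by the energy `E(g) = ∬ g(a) g(b) ∏_i |a_i - b_i|^{2H_i-2} da db` of a
nonnegative function `g` on space-time.

*The heat kernel has finite energy.* Convolving `G_τ` with `∏_i |·|^{2H_i-2}` in space gives at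
most a constant times `τ^{∑ (H_i - 1)}`, uniformly in the point. Of the two factors in the energy,
integrate the one with the larger elapsed time in this way; the other one has mass `1`, and the
remaining time integral converges exactly when `2H_0 + ∑ H_i > d`
(`lintegral_heatWeight_mul_hurstKernel_lt_top`), which the hypothesis on the Hurst indices
implies.

*Random integrands.* The integrand is `G` times a coefficient whose moments of order at most `p`
are bounded uniformly, so Jensen's inequality for the finite measure
`G(a) G(b) ∏_i |a_i - b_i|^{2H_i-2}` bounds the `m`-th moment of the energy of a path when
`2m ≤ p` (`lintegral_energy_pow_lt_top`). The case `m = 1` gives the membership in `𝓗` and, because the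
squared norm of `f^{⊗q}` is the `q`-th power of that of `f` (`tensorNormSq_tensorPow`), also in
`𝓗^{⊗q}`; the case `m = q` gives the bound for the mean of the squared norm of `f^{⊗q}`.

*The integral of a path.* The inner product of the kernels `∏_j ∏_i (a_i - y_{j,i})_+^{-γ_i}` and
`∏_j ∏_i (b_i - y_{j,i})_+^{-γ_i}` is of order `∏_i |a_i - b_i|^{2H_i-2}`, so the `L²` norm of the
kernel attached to a path is bounded by its energy (`exists_lintegral_sq_transferKernel_le`). The
kernel is symmetric. Multiple integrals of symmetric `L²` kernels exist and are unique
(`exists_isMultipleIntegral`, `isMultipleIntegral_unique`) because elementary kernels are dense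
(`exists_elementaryKernel_eLpNorm_sub_le`) and `I_q` is bounded on them
(`ElementaryKernel.eLpNorm_integral_sub_le`).

*The Skorohod pairing.* The random kernel is in `L²(Ω × (ℝ^{d+1})^q)` since its squared norm is
bounded by the mean energy, and the derivatives `D^q G` are square integrable because Gaussian
variables have moments of all orders (`memLp_malliavinDeriv`); Cauchy–Schwarz then bounds the
pairing.
-/

/-! ### One-dimensional integrals -/

theorem lintegral_pi_prod {n : ℕ} {E : Type*} [MeasurableSpace E] (μ : Fin n → Measure E)
    [∀ i, SigmaFinite (μ i)] (f : Fin n → E → ℝ≥0∞) (hf : ∀ i, Measurable (f i)) :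
    ∫⁻ x, ∏ i, f i (x i) ∂Measure.pi μ = ∏ i, ∫⁻ x, f i x ∂μ i := by
  induction n with
  | zero => simp
  | succ n ih =>
    have e := measurePreserving_piFinSuccAbove μ 0
    rw [← e.symm.lintegral_comp (by fun_prop), Fin.prod_univ_succ, ← ih (fun i =>
        μ i.succ) (fun i => f i.succ) (fun i => hf _)]
    simp only [Fin.prod_univ_succ, MeasurableEquiv.piFinSuccAbove_symm_apply]
    have hm : Measurable fun y : Fin n → E => ∏ i : Fin n, f i.succ (y i) :=
      Finset.measurable_prod _ fun i _ => (hf _).comp (measurable_pi_apply i)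
    refine Eq.trans ?_ (lintegral_prod_mul (hf 0).aemeasurable hm.aemeasurable)
    simp [Fin.insertNthEquiv]

theorem lintegral_rpow_Ioc {s δ : ℝ} (hs : -1 < s) (hδ : 0 ≤ δ) :
    ∫⁻ w in Set.Ioc 0 δ, ENNReal.ofReal (w ^ s) = ENNReal.ofReal (δ ^ (s + 1) / (s + 1)) := by
  have h1 := intervalIntegral.intervalIntegrable_rpow' (a := 0) (b := δ) hs
  rw [intervalIntegrable_iff_integrableOn_Ioc_of_le hδ] at h1
  rw [← ofReal_integral_eq_lintegral_ofReal h1]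
  · rw [← intervalIntegral.integral_of_le hδ, integral_rpow (Or.inl hs),
      Real.zero_rpow (by linarith), sub_zero]
  · filter_upwards [ae_restrict_mem measurableSet_Ioc] with w hw using Real.rpow_nonneg hw.1.le _

theorem lintegral_rpow_Ioi {s δ : ℝ} (hs : s < -1) (hδ : 0 < δ) :
    ∫⁻ w in Set.Ioi δ, ENNReal.ofReal (w ^ s) = ENNReal.ofReal (-δ ^ (s + 1) / (s + 1)) := by
  rw [← ofReal_integral_eq_lintegral_ofReal (integrableOn_Ioi_rpow_of_lt hs hδ),
    integral_Ioi_rpow_of_lt hs hδ]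
  filter_upwards [ae_restrict_mem measurableSet_Ioi] with w hw
  exact Real.rpow_nonneg (hδ.trans hw).le _

/-- With `w = a - y` and `δ = b - a` the integrand is `w^{-γ} (w+δ)^{-γ}`; it is at most
`δ^{-γ} w^{-γ}` for `w ≤ δ` and at most `w^{-2γ}` for `w > δ`, and both bounds are integrable
because `1/2 < γ < 1`. -/
theorem lintegral_max_rpow_mul_le_aux {γ : ℝ} (h1 : 1 / 2 < γ) (h2 : γ < 1) {a b : ℝ}
    (hab : a < b) :
    ∫⁻ y, ENNReal.ofReal ((max (a - y) 0) ^ (-γ)) * ENNReal.ofReal ((max (b - y) 0) ^ (-γ)) ≤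
      ENNReal.ofReal (1 / (1 - γ) + 1 / (2 * γ - 1)) * ENNReal.ofReal (|a - b| ^ (1 - 2 * γ)) := by
  have hδ : 0 < b - a := by linarith
  rw [← lintegral_sub_left_eq_self _ a]
  have key : ∀ w : ℝ, ENNReal.ofReal ((max (a - (a - w)) 0) ^ (-γ)) *
        ENNReal.ofReal ((max (b - (a - w)) 0) ^ (-γ)) ≤
      (Set.Ioc 0 (b - a)).indicator (fun w => ENNReal.ofReal ((b - a) ^ (-γ)) *
        ENNReal.ofReal (w ^ (-γ))) w +
      (Set.Ioi (b - a)).indicator (fun w => ENNReal.ofReal (w ^ (-(2 * γ)))) w := by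
    intro w
    rcases le_or_gt w 0 with hw | hw
    · have : max (a - (a - w)) 0 = 0 := by simpa using hw
      rw [this, Real.zero_rpow (by linarith)]
      simp
    · have e1 : max (a - (a - w)) 0 = w := by rw [max_eq_left] <;> linarith
      have e2 : max (b - (a - w)) 0 = b - a + w := by rw [max_eq_left] <;> linarith
      rw [e1, e2]
      rcases le_or_gt w (b - a) with hw' | hw'
      · rw [Set.indicator_of_mem (Set.mem_Ioc.2 ⟨hw, hw'⟩), mul_comm]
        refine le_add_right (mul_le_mul_left (ENNReal.ofReal_le_ofReal ?_) _)
        exact Real.rpow_le_rpow_of_nonpos hδ (by linarith) (by linarith)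
      · rw [Set.indicator_of_mem (Set.mem_Ioi.2 hw'), ← ENNReal.ofReal_mul (by positivity)]
        refine le_add_left (ENNReal.ofReal_le_ofReal ?_)
        rw [show -(2 * γ) = -γ + -γ by ring, Real.rpow_add hw]
        exact mul_le_mul_of_nonneg_left
          (Real.rpow_le_rpow_of_nonpos hw (by linarith) (by linarith)) (by positivity)
  refine (lintegral_mono key).trans ?_
  rw [lintegral_add_left (by measurability), lintegral_indicator measurableSet_Ioc,
    lintegral_indicator measurableSet_Ioi, lintegral_const_mul _ (by fun_prop),
    lintegral_rpow_Ioc (by linarith) hδ.le, lintegral_rpow_Ioi (by linarith) hδ,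
    ← ENNReal.ofReal_mul (by positivity), ← ENNReal.ofReal_mul, ← ENNReal.ofReal_add]
  · apply ENNReal.ofReal_le_ofReal
    rw [abs_sub_comm, abs_of_pos hδ, show 1 - 2 * γ = -γ + (-γ + 1) by ring,
        Real.rpow_add hδ (-γ) (-γ + 1),
      show -(2 * γ) + 1 = -γ + (-γ + 1) by ring, Real.rpow_add hδ (-γ) (-γ + 1)]
    have : 1 - γ ≠ 0 := by linarith
    have : 2 * γ - 1 ≠ 0 := by linarith
    have e3 : -γ + (-γ + 1) = - (2 * γ - 1) := by ring
    rw [e3, neg_div_neg_eq, show -γ + 1 = 1 - γ by ring]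
    apply le_of_eq
    ring
  · have : 0 < 1 - γ := by linarith
    have : 0 < -γ + 1 := by linarith
    positivity
  · rw [neg_div, ← div_neg]
    have : 0 < -(-(2 * γ) + 1) := by linarith
    positivity
  · have : 0 < 1 - γ := by linarith
    have : 0 < 2 * γ - 1 := by linarith
    positivity

/-- The one-dimensional fractional kernels `(a-·)_+^{-γ}` have inner product of order
`|a-b|^{1-2γ}`. For `a = b` the left side is infinite, while `Real.rpow` makes the right side `0`. -/
theorem lintegral_max_rpow_mul_le {γ : ℝ} (h1 : 1 / 2 < γ) (h2 : γ < 1) {a b : ℝ} (hab : a ≠ b) :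
    ∫⁻ y, ENNReal.ofReal ((max (a - y) 0) ^ (-γ)) * ENNReal.ofReal ((max (b - y) 0) ^ (-γ)) ≤
      ENNReal.ofReal (1 / (1 - γ) + 1 / (2 * γ - 1)) * ENNReal.ofReal (|a - b| ^ (1 - 2 * γ)) := by
  rcases lt_or_gt_of_ne hab with h | h
  · exact lintegral_max_rpow_mul_le_aux h1 h2 h
  · rw [abs_sub_comm]
    simp_rw [mul_comm (ENNReal.ofReal ((max (a - _) 0) ^ (-γ)))]
    exact lintegral_max_rpow_mul_le_aux h1 h2 h

/-- The convolution of a Gaussian density of variance `v` with `|·|^{2h-2}` is bounded by a multiple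
of `v^{h-1}`, uniformly in the point: at distance at most `√v` from `z` the density is at most
`v^{-1/2}`, and farther away the power is at most `v^{h-1}`. -/
theorem lintegral_gaussian_mul_rpow_le {h : ℝ} (h1 : 1 / 2 < h) (h2 : h < 1) (x z : ℝ) {v : ℝ≥0}
    (hv : v ≠ 0) :
    ∫⁻ y, ENNReal.ofReal (gaussianPDFReal x v y) * ENNReal.ofReal (|y - z| ^ (2 * h - 2)) ≤
      ENNReal.ofReal (2 / (2 * h - 1) + 1) * ENNReal.ofReal ((v : ℝ) ^ (h - 1)) := by
  have hv' : (0 : ℝ) < v := by positivity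
  set r : ℝ := √v with hr
  have hr0 : 0 < r := Real.sqrt_pos.2 hv'
  have hs : ∀ w : ℝ, (v : ℝ) ^ w = r ^ (2 * w) := fun w => by
    rw [hr, Real.sqrt_eq_rpow, ← Real.rpow_mul hv'.le]; congr 1; ring
  have pdf : ∀ y, gaussianPDFReal x v y ≤ r⁻¹ := by
    intro y
    rw [gaussianPDFReal]
    have : Real.exp (-(y - x) ^ 2 / (2 * v)) ≤ 1 := by
      rw [Real.exp_le_one_iff, neg_div]; have :=
          div_nonneg (sq_nonneg (y-x)) (by positivity : (0:ℝ) ≤ 2 * v); linarith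
    calc _ ≤ (√(2 * Real.pi * v))⁻¹ * 1 := by gcongr
      _ ≤ r⁻¹ := by
        rw [mul_one]
        refine inv_anti₀ hr0 (Real.sqrt_le_sqrt ?_)
        have := Real.pi_gt_three
        nlinarith
  have key : ∀ y : ℝ, ENNReal.ofReal (gaussianPDFReal x v y) * ENNReal.ofReal (|y - z| ^ (2 *
      h - 2)) ≤
      ENNReal.ofReal r⁻¹ * ((fun w => (Set.Ioc 0 r).indicator (fun w =>
          ENNReal.ofReal (w ^ (2 * h - 2))) w + (Set.Ioc 0 r).indicator (fun w =>
          ENNReal.ofReal (w ^ (2 * h - 2))) (-w)) (y - z)) +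
      ENNReal.ofReal (r ^ (2 * h - 2)) * gaussianPDF x v y := by
    intro y
    rcases le_or_gt |y - z| r with hy | hy
    · refine le_add_right (mul_le_mul' (ENNReal.ofReal_le_ofReal (pdf y)) ?_)
      rcases lt_trichotomy (y - z) 0 with h0 | h0 | h0
      · rw [abs_of_neg h0] at hy ⊢
        refine le_add_left ?_
        rw [Set.indicator_of_mem (Set.mem_Ioc.2 ⟨by linarith, hy⟩)]
      · rw [h0, abs_zero, Real.zero_rpow (by linarith)]; simp
      · rw [abs_of_pos h0] at hy ⊢
        refine le_add_right ?_
        rw [Set.indicator_of_mem (Set.mem_Ioc.2 ⟨by linarith, hy⟩)]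
    · refine le_add_left ?_
      rw [mul_comm, gaussianPDF]
      refine mul_le_mul_left (ENNReal.ofReal_le_ofReal ?_) _
      exact Real.rpow_le_rpow_of_nonpos hr0 hy.le (by linarith)
  have hm : Measurable ((Set.Ioc 0 r).indicator (fun w : ℝ => ENNReal.ofReal (w ^ (2 * h - 2)))) :=
    Measurable.indicator (by fun_prop) measurableSet_Ioc
  refine (lintegral_mono key).trans ?_
  rw [lintegral_add_right _ (by fun_prop), lintegral_const_mul _ (by fun_prop),
      lintegral_const_mul _ (by fun_prop),
    lintegral_gaussianPDF_eq_one x hv, lintegral_sub_right_eq_self (fun w =>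
        (Set.Ioc 0 r).indicator (fun w =>
        ENNReal.ofReal (w ^ (2 * h - 2))) w + (Set.Ioc 0 r).indicator (fun w =>
        ENNReal.ofReal (w ^ (2 * h - 2))) (-w)) z,
    lintegral_add_left hm, lintegral_neg_eq_self ((Set.Ioc 0 r).indicator (fun w =>
        ENNReal.ofReal (w ^ (2 * h - 2)))),
    lintegral_indicator measurableSet_Ioc, lintegral_rpow_Ioc (by linarith) hr0.le]
  have : 0 < 2 * h - 1 := by linarith
  have h3 : 2 * h - 2 + 1 = 2 * h - 1 := by ring
  rw [mul_one, ← ENNReal.ofReal_add (by rw [h3]; positivity) (by rw [h3]; positivity),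
      ← ENNReal.ofReal_mul (by positivity), ← ENNReal.ofReal_mul (by positivity),
      ← ENNReal.ofReal_add (by rw [h3]; positivity) (by positivity), hs, h3]
  apply ENNReal.ofReal_le_ofReal
  apply le_of_eq
  rw [show 2 * (h - 1) = (2 * h - 1) - 1 by ring, show 2 * h - 2 = (2 * h - 1) - 1 by ring,
    Real.rpow_sub_one hr0.ne' (2 * h - 1)]
  generalize r ^ (2 * h - 1) = k
  field_simp
  ring

/-! ### The energy of the heat kernel -/

/-- The heat kernel as a product of one-dimensional Gaussian densities of variance `2ντ`. -/
theorem heatKernel_eq_prod {d : ℕ} {ν τ : ℝ} (hν : 0 < ν) (hτ : 0 < τ) (x y : Fin d → ℝ) :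
    heatKernel ν τ (x - y) = ∏ i, gaussianPDFReal (x i) (2 * ν * τ).toNNReal (y i) := by
  have h : 0 < 2 * ν * τ := by positivity
  simp only [heatKernel, gaussianPDFReal, Real.coe_toNNReal _ h.le, Finset.prod_mul_distrib,
    Finset.prod_const, Finset.card_univ, Fintype.card_fin, ← Real.exp_sum, Pi.sub_apply]
  congr 1
  · rw [Real.sqrt_eq_rpow, ← Real.rpow_neg (by positivity), ← Real.rpow_mul_natCast (by positivity)]
    congr 1 <;> ring
  · rw [← Finset.sum_div, Finset.sum_neg_distrib]
    congr 2
    · congr 1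
      exact Finset.sum_congr rfl fun i _ => by ring
    · ring

theorem lintegral_heatKernel {d : ℕ} {ν τ : ℝ} (hν : 0 < ν) (hτ : 0 < τ) (x : Fin d → ℝ) :
    ∫⁻ y, ENNReal.ofReal (heatKernel ν τ (x - y)) = 1 := by
  have hv : (2 * ν * τ).toNNReal ≠ 0 := (Real.toNNReal_pos.2 (by positivity)).ne'
  simp_rw [heatKernel_eq_prod hν hτ,
    ENNReal.ofReal_prod_of_nonneg fun i _ => gaussianPDFReal_nonneg _ _ _]
  rw [volume_pi, lintegral_pi_prod _ (fun i y =>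
      ENNReal.ofReal (gaussianPDFReal (x i) _ y)) (fun i => by fun_prop)]
  exact Finset.prod_eq_one fun i _ => lintegral_gaussianPDF_eq_one _ hv

/-- The spatial part of the energy: the constant depends on `ν` and the Hurst indices only, not on
the time `τ` or the points `x`, `z`. -/
theorem exists_lintegral_heatKernel_mul_rpow_le {d : ℕ} {ν : ℝ} (hν : 0 < ν) (h : Fin d → ℝ)
    (hh : ∀ i, h i ∈ Set.Ioo (1 / 2 : ℝ) 1) :
    ∃ C : ℝ≥0∞, C ≠ ∞ ∧ ∀ τ, 0 < τ → ∀ x z : Fin d → ℝ,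
      ∫⁻ y, ENNReal.ofReal (heatKernel ν τ (x - y)) *
        ∏ i, ENNReal.ofReal (|y i - z i| ^ (2 * h i - 2)) ≤
      C * ENNReal.ofReal (τ ^ (∑ i, (h i - 1))) := by
  refine ⟨(∏ i, ENNReal.ofReal (2 / (2 * h i - 1) + 1)) * ∏ i, ENNReal.ofReal ((2 * ν) ^ (h i - 1)),
    ENNReal.mul_ne_top (ENNReal.prod_ne_top fun i _ => ENNReal.ofReal_ne_top)
      (ENNReal.prod_ne_top fun i _ => ENNReal.ofReal_ne_top), fun τ hτ x z => ?_⟩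
  have h0 : 0 < 2 * ν * τ := by positivity
  have hv : (2 * ν * τ).toNNReal ≠ 0 := (Real.toNNReal_pos.2 h0).ne'
  simp_rw [heatKernel_eq_prod hν hτ,
    ENNReal.ofReal_prod_of_nonneg fun i _ =>
        gaussianPDFReal_nonneg _ _ _, ← Finset.prod_mul_distrib]
  rw [volume_pi, lintegral_pi_prod _ (fun i y => ENNReal.ofReal (gaussianPDFReal (x i) _ y) *
    ENNReal.ofReal (|y - z i| ^ (2 * h i - 2))) (fun i => by fun_prop),
    Real.rpow_sum_of_pos hτ, ENNReal.ofReal_prod_of_nonneg fun i _ => by positivity,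
    ← Finset.prod_mul_distrib]
  refine Finset.prod_le_prod' fun i _ => ?_
  refine (lintegral_gaussian_mul_rpow_le (hh i).1 (hh i).2 (x i) (z i) hv).trans (le_of_eq ?_)
  rw [Real.coe_toNNReal _ h0.le, Real.mul_rpow (by positivity) hτ.le,
      ENNReal.ofReal_mul (by positivity), mul_assoc]

/-- Tonelli for the splitting of space-time into time and space. -/
theorem lintegral_spaceTime {d : ℕ} {F : SpaceTime d → ℝ≥0∞} (hF : Measurable F) :
    ∫⁻ a, F a = ∫⁻ s : ℝ, ∫⁻ y : Fin d → ℝ, F (Fin.cons s y) := by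
  have e := volume_preserving_piFinSuccAbove (fun _ : Fin (d + 1) => ℝ) 0
  rw [← e.symm.lintegral_comp hF, Measure.volume_eq_prod, lintegral_prod _ (by fun_prop)]
  simp [Fin.insertNthEquiv]

/-- The heat kernel `G_{t-s}(x-y)` at `(s,y)`, cut off to `0 ≤ s < t`. -/
noncomputable def heatWeight {d : ℕ} (ν t : ℝ) (x : Fin d → ℝ) (a : SpaceTime d) : ℝ≥0∞ :=
  if 0 ≤ a 0 ∧ a 0 < t then ENNReal.ofReal (heatKernel ν (t - a 0) (x - Fin.tail a)) else 0

/-- `∏_i |a_i - b_i|^{2H_i-2}`, the covariance density without its constant. -/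
noncomputable def hurstKernel {d : ℕ} (H : Fin (d + 1) → ℝ) (a b : SpaceTime d) : ℝ≥0∞ :=
  ∏ i, ENNReal.ofReal (|a i - b i| ^ (2 * H i - 2))

theorem heatWeight_of_mem {d : ℕ} (ν : ℝ) {t : ℝ} (x : Fin d → ℝ) {a : SpaceTime d}
    (ha : 0 ≤ a 0 ∧ a 0 < t) :
    heatWeight ν t x a = ENNReal.ofReal (heatKernel ν (t - a 0) (x - Fin.tail a)) :=
  if_pos ha

theorem heatWeight_of_notMem {d : ℕ} (ν : ℝ) {t : ℝ} (x : Fin d → ℝ) {a : SpaceTime d}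
    (ha : ¬(0 ≤ a 0 ∧ a 0 < t)) : heatWeight ν t x a = 0 :=
  if_neg ha

theorem hurstKernel_comm {d : ℕ} (H : Fin (d + 1) → ℝ) (a b : SpaceTime d) :
    hurstKernel H a b = hurstKernel H b a := by
  simp only [hurstKernel, abs_sub_comm]

@[fun_prop]
theorem measurable_heatKernel {d : ℕ} (ν : ℝ) :
    Measurable fun p : ℝ × (Fin d → ℝ) => heatKernel ν p.1 p.2 := by
  unfold heatKernel
  fun_prop

theorem measurable_tail {d : ℕ} : Measurable (Fin.tail : SpaceTime d → Fin d → ℝ) :=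
  measurable_pi_lambda _ fun i => measurable_pi_apply i.succ

theorem measurableSet_timeSlab {d : ℕ} (t : ℝ) :
    MeasurableSet {a : SpaceTime d | 0 ≤ a 0 ∧ a 0 < t} :=
  (measurableSet_le measurable_const (measurable_pi_apply 0)).inter
    (measurableSet_lt (measurable_pi_apply 0) measurable_const)

theorem measurable_heatWeight {d : ℕ} (ν t : ℝ) (x : Fin d → ℝ) :
    Measurable (heatWeight ν t x) := by
  refine Measurable.ite (measurableSet_timeSlab t) ?_ measurable_const
  refine ((measurable_heatKernel ν).comp
    (Measurable.prodMk (by fun_prop) (measurable_const.sub measurable_tail))).ennreal_ofReal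

@[fun_prop]
theorem Measurable.hurstKernel {α : Type*} [MeasurableSpace α] {d : ℕ} (H : Fin (d + 1) → ℝ)
    {f g : α → SpaceTime d} (hf : Measurable f) (hg : Measurable g) :
    Measurable fun x => hurstKernel H (f x) (g x) := by
  unfold _root_.hurstKernel
  fun_prop

/-- The time part of the energy. Integrating first over the later time `r` leaves
`∫_0^t (t-s)^{2h-1+e} ds`, so that `2h + e > 0` is what convergence needs. -/
theorem lintegral_time_lt_top {h e t : ℝ} (h1 : 1 / 2 < h) (h2 : h < 1) (he : 0 < 2 * h +
    e) (ht : 0 < t) :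
    ∫⁻ r : ℝ, ∫⁻ s : ℝ, (Set.Ico 0 t).indicator 1 r * ((Set.Icc 0 r).indicator 1 s *
      (ENNReal.ofReal (|s - r| ^ (2 * h - 2)) * ENNReal.ofReal ((t - s) ^ e))) < ∞ := by
  have hm : Measurable fun p : ℝ × ℝ => (Set.Ico 0 t).indicator (1 : ℝ → ℝ≥0∞) p.1 *
      ((Set.Icc 0 p.1).indicator 1 p.2 *
      (ENNReal.ofReal (|p.2 - p.1| ^ (2 * h - 2)) * ENNReal.ofReal ((t - p.2) ^ e))) := by
    refine Measurable.mul ((measurable_one.indicator measurableSet_Ico).comp measurable_fst)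
      (Measurable.mul ?_ (by fun_prop))
    exact (measurable_one (α := ℝ≥0∞)).indicator (s := {p : ℝ × ℝ | 0 ≤ p.2 ∧ p.2 ≤ p.1})
      ((measurableSet_le measurable_const measurable_snd).inter
        (measurableSet_le measurable_snd measurable_fst))
  rw [lintegral_lintegral_swap hm.aemeasurable]
  have hp : 0 < 2 * h - 1 := by linarith
  have inner : ∀ s : ℝ, ∫⁻ r : ℝ, (Set.Ico 0 t).indicator 1 r * ((Set.Icc 0 r).indicator 1 s *
      (ENNReal.ofReal (|s - r| ^ (2 * h - 2)) * ENNReal.ofReal ((t - s) ^ e))) ≤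
      ENNReal.ofReal (1 / (2 * h - 1)) *
        (Set.Ioc 0 t).indicator (fun w => ENNReal.ofReal (w ^ (2 * h - 1 + e))) (t - s) := by
    intro s
    by_cases hs : 0 ≤ s ∧ s < t
    · have hts : 0 < t - s := by linarith
      have key : ∀ r : ℝ, (Set.Ico 0 t).indicator 1 r * ((Set.Icc 0 r).indicator 1 s *
          (ENNReal.ofReal (|s - r| ^ (2 * h - 2)) * ENNReal.ofReal ((t - s) ^ e))) ≤
          ENNReal.ofReal ((t - s) ^ e) * (fun w => (Set.Ioc 0 (t - s)).indicator
            (fun w => ENNReal.ofReal (w ^ (2 * h - 2))) w) (r - s) := by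
        intro r
        by_cases hr : r ∈ Set.Ico 0 t
        · by_cases hr' : s ∈ Set.Icc 0 r
          · simp only [Set.indicator_of_mem hr, Set.indicator_of_mem hr', Pi.one_apply, one_mul]
            rw [mul_comm]
            refine mul_le_mul_right ?_ _
            rcases hr'.2.eq_or_lt with h0 | h0
            · rw [h0, sub_self, abs_zero, Real.zero_rpow (by linarith)]
              simp
            · rw [Set.indicator_of_mem (Set.mem_Ioc.2 ⟨by linarith, by linarith [hr.2]⟩),
                abs_sub_comm, abs_of_pos (by linarith)]
          · simp [Set.indicator_of_notMem hr']
        · simp [Set.indicator_of_notMem hr]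
      refine (lintegral_mono key).trans ?_
      have hm' : Measurable ((Set.Ioc 0 (t - s)).indicator
          (fun w => ENNReal.ofReal (w ^ (2 * h - 2)))) :=
        Measurable.indicator (by fun_prop) measurableSet_Ioc
      rw [lintegral_const_mul _ (by fun_prop), lintegral_sub_right_eq_self (fun w =>
        (Set.Ioc 0 (t - s)).indicator (fun w => ENNReal.ofReal (w ^ (2 * h - 2))) w),
        lintegral_indicator measurableSet_Ioc, lintegral_rpow_Ioc (by linarith) hts.le,
        Set.indicator_of_mem (Set.mem_Ioc.2 ⟨hts, by linarith⟩),
            ← ENNReal.ofReal_mul (by positivity),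
        ← ENNReal.ofReal_mul (by positivity), Real.rpow_add hts (2 * h - 1) e,
        show 2 * h - 2 + 1 = 2 * h - 1 by ring]
      exact ENNReal.ofReal_le_ofReal (le_of_eq (by ring))
    · have : ∀ r : ℝ, (Set.Ico 0 t).indicator 1 r * ((Set.Icc 0 r).indicator 1 s *
          (ENNReal.ofReal (|s - r| ^ (2 * h - 2)) * ENNReal.ofReal ((t - s) ^ e))) = 0 := by
        intro r
        by_cases hr : r ∈ Set.Ico 0 t
        · have hr' : s ∉ Set.Icc 0 r := fun h' => hs ⟨h'.1, h'.2.trans_lt hr.2⟩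
          simp [Set.indicator_of_notMem hr']
        · simp [Set.indicator_of_notMem hr]
      simp [this]
  have hm' : Measurable ((Set.Ioc 0 t).indicator
      (fun w => ENNReal.ofReal (w ^ (2 * h - 1 + e)))) :=
    Measurable.indicator (by fun_prop) measurableSet_Ioc
  refine (lintegral_mono inner).trans_lt ?_
  rw [lintegral_const_mul _ (by fun_prop), lintegral_sub_left_eq_self _ t,
      lintegral_indicator measurableSet_Ioc, lintegral_rpow_Ioc (by linarith) ht.le]
  exact ENNReal.mul_lt_top ENNReal.ofReal_lt_top ENNReal.ofReal_lt_top

/-- The energy of the heat kernel is finite if `d < 2 H_0 + ∑ H_i`. -/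
theorem lintegral_heatWeight_mul_hurstKernel_lt_top {d : ℕ} {ν t : ℝ} (hν : 0 < ν) (ht : 0 < t)
    {H : Fin (d + 1) → ℝ} (hH : ∀ i, H i ∈ Set.Ioo (1 / 2 : ℝ) 1)
    (hsum : (d : ℝ) < 2 * H 0 + ∑ i : Fin d, H i.succ) (x : Fin d → ℝ) :
    ∫⁻ b, ∫⁻ a, heatWeight ν t x a * heatWeight ν t x b * hurstKernel H a b < ∞ := by
  obtain ⟨C, hC, hCle⟩ := exists_lintegral_heatKernel_mul_rpow_le hν (fun i => H i.succ)
    fun i => hH i.succ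
  set e : ℝ := ∑ i : Fin d, (H i.succ - 1) with he
  have he' : 0 < 2 * H 0 + e := by
    rw [he, Finset.sum_sub_distrib]; simp; linarith
  set G := heatWeight ν t x with hG
  have mG : Measurable G := measurable_heatWeight ν t x
  -- By symmetry it suffices to integrate over the pairs in which `a` is earlier than `b`. There
  -- `t - a 0` is the larger of the two elapsed times, and the spatial integral over `a` gives the
  -- factor `(t - a 0)^e` whatever `b` is; the spatial integral over `b` is then `1`.
  set Q : SpaceTime d → SpaceTime d → ℝ≥0∞ := fun b a =>
    if a 0 ≤ b 0 then G a * G b * hurstKernel H a b else 0 with hQ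
  have mQ : Measurable (Function.uncurry Q) := by
    have m1 : MeasurableSet {p : SpaceTime d × SpaceTime d | p.2 0 ≤ p.1 0} :=
      measurableSet_le (by fun_prop) (by fun_prop)
    have m3 : Measurable fun p : SpaceTime d × SpaceTime d =>
        G p.2 * G p.1 * hurstKernel H p.2 p.1 := by fun_prop
    exact Measurable.ite m1 m3 measurable_const
  have mQ' : ∀ b, Measurable (Q b) := fun b => mQ.of_uncurry_left
  have half : ∫⁻ b, ∫⁻ a, Q b a < ∞ := by
    have inner : ∀ b : SpaceTime d, ∫⁻ a, Q b a ≤ C * (G b * ∫⁻ s : ℝ,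
        (Set.Icc 0 (b 0)).indicator 1 s *
      (ENNReal.ofReal (|s - b 0| ^ (2 * H 0 - 2)) * ENNReal.ofReal ((t - s) ^ e))) := by
      intro b
      by_cases hb : 0 ≤ b 0 ∧ b 0 < t
      swap
      · have : G b = 0 := heatWeight_of_notMem ν x hb
        simp [hQ, this]
      rw [lintegral_spaceTime (mQ' b), ← mul_assoc, ← lintegral_const_mul]
      swap
      · exact Measurable.mul (measurable_one.indicator measurableSet_Icc) (by fun_prop)
      refine lintegral_mono fun s => ?_
      by_cases hs : s ∈ Set.Icc 0 (b 0)
      · have hts : 0 < t - s := by linarith [hs.2, hb.2]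
        have h1 : ∀ y : Fin d → ℝ, Q b (Fin.cons s y) =
            (G b * ENNReal.ofReal (|s - b 0| ^ (2 * H 0 - 2))) *
            (ENNReal.ofReal (heatKernel ν (t - s) (x - y)) *
              ∏ i, ENNReal.ofReal (|y i - Fin.tail b i| ^ (2 * H i.succ - 2))) := by
          intro y
          have e1 : G (Fin.cons s y) = ENNReal.ofReal (heatKernel ν (t - s) (x - y)) := by
            have h0 : 0 ≤ (Fin.cons s y : SpaceTime d) 0 ∧ (Fin.cons s y : SpaceTime d) 0 < t :=
              ⟨hs.1, hs.2.trans_lt hb.2⟩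
            rw [hG, heatWeight_of_mem ν x h0, Fin.cons_zero, Fin.tail_cons]
          have h0 : (Fin.cons s y : SpaceTime d) 0 ≤ b 0 := hs.2
          simp only [hQ]
          rw [if_pos h0, e1, hurstKernel, Fin.prod_univ_succ]
          simp only [Fin.cons_zero, Fin.cons_succ, Fin.tail]
          ring
        simp_rw [h1]
        have mk : Measurable fun y : Fin d → ℝ => heatKernel ν (t - s) (x - y) :=
          (measurable_heatKernel ν).comp (measurable_const.prodMk (by fun_prop))
        rw [lintegral_const_mul _ (by fun_prop), Set.indicator_of_mem hs]
        calc _ ≤ (G b * ENNReal.ofReal (|s - b 0| ^ (2 * H 0 - 2))) * (C *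
            ENNReal.ofReal ((t - s) ^ e)) := by
              gcongr; exact hCle _ hts _ _
          _ = _ := by simp only [Pi.one_apply]; ring
      · have h1 : ∀ y : Fin d → ℝ, Q b (Fin.cons s y) = 0 := by
          intro y
          by_cases h0 : s ≤ b 0
          · have : G (Fin.cons s y) = 0 := heatWeight_of_notMem ν x fun h' => hs ⟨h'.1, h0⟩
            simp [hQ, this]
          · simp only [hQ]
            rw [if_neg (by simpa using h0)]
        simp [h1]
    refine (lintegral_mono inner).trans_lt ?_
    have mT : Measurable fun r : ℝ => ∫⁻ s : ℝ, (Set.Icc 0 r).indicator 1 s *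
        (ENNReal.ofReal (|s - r| ^ (2 * H 0 - 2)) * ENNReal.ofReal ((t - s) ^ e)) := by
      refine Measurable.lintegral_prod_right' (f :=
          fun p : ℝ × ℝ => (Set.Icc 0 p.1).indicator 1 p.2 *
        (ENNReal.ofReal (|p.2 - p.1| ^ (2 * H 0 - 2)) * ENNReal.ofReal ((t - p.2) ^ e))) ?_
      refine Measurable.mul ?_ (by fun_prop)
      exact (measurable_one (α := ℝ≥0∞)).indicator (s := {p : ℝ × ℝ | 0 ≤ p.2 ∧ p.2 ≤ p.1})
        ((measurableSet_le measurable_const measurable_snd).inter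
          (measurableSet_le measurable_snd measurable_fst))
    have mR : Measurable fun b : SpaceTime d => G b * ∫⁻ s : ℝ, (Set.Icc 0 (b 0)).indicator 1 s *
        (ENNReal.ofReal (|s - b 0| ^ (2 * H 0 - 2)) * ENNReal.ofReal ((t - s) ^ e)) :=
      mG.mul (mT.comp (measurable_pi_apply 0))
    rw [lintegral_const_mul _ mR, lintegral_spaceTime mR]
    refine ENNReal.mul_lt_top hC.lt_top (lt_of_le_of_lt (lintegral_mono fun r => ?_)
      (lintegral_time_lt_top (hH 0).1 (hH 0).2 he' ht))
    by_cases hr : 0 ≤ r ∧ r < t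
    · have e1 : ∀ y : Fin d → ℝ, G (Fin.cons r y) =
        ENNReal.ofReal (heatKernel ν (t - r) (x - y)) := by
        intro y
        have h0 : 0 ≤ (Fin.cons r y : SpaceTime d) 0 ∧ (Fin.cons r y : SpaceTime d) 0 < t := hr
        rw [hG, heatWeight_of_mem ν x h0, Fin.cons_zero, Fin.tail_cons]
      have mk : Measurable fun y : Fin d → ℝ => heatKernel ν (t - r) (x - y) :=
          (measurable_heatKernel ν).comp (measurable_const.prodMk (by fun_prop))
      simp only [e1, Fin.cons_zero]
      rw [lintegral_mul_const _ (by fun_prop), lintegral_heatKernel hν (by linarith [hr.2]),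
          one_mul,
        Set.indicator_of_mem (Set.mem_Ico.2 hr)]
      simp
    · have e1 : ∀ y : Fin d → ℝ, G (Fin.cons r y) = 0 := fun y =>
        heatWeight_of_notMem ν x hr
      simp [e1]
  have split : ∀ b a, G a * G b * hurstKernel H a b ≤ Q b a + Q a b := by
    intro b a
    rcases le_total (a 0) (b 0) with h | h
    · refine le_add_right ?_
      simp only [hQ]
      rw [if_pos h]
    · refine le_add_left ?_
      simp only [hQ]
      rw [if_pos h, hurstKernel_comm, mul_comm (G a)]
  refine (lintegral_mono fun b => lintegral_mono fun a => split b a).trans_lt ?_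
  have : ∀ b, ∫⁻ a, (Q b a + Q a b) = (∫⁻ a, Q b a) + ∫⁻ a, Q a b := fun b =>
    lintegral_add_left (mQ' b) _
  simp_rw [this]
  have mI : Measurable fun b => ∫⁻ a, Q b a := mQ.lintegral_prod_right'
  have mS : Measurable (Function.uncurry fun b a => Q a b) := mQ.comp measurable_swap
  rw [lintegral_add_left mI, lintegral_lintegral_swap mS.aemeasurable]
  exact ENNReal.add_lt_top.2 ⟨half, half⟩

/-! ### The kernel of the integral against the Hermite noise -/

theorem fracKernel_nonneg {d q : ℕ} (H : Fin (d + 1) → ℝ) (a : SpaceTime d)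
    (y : Fin q → SpaceTime d) : 0 ≤ fracKernel q H a y :=
  Finset.prod_nonneg fun _ _ => Finset.prod_nonneg fun _ _ =>
    Real.rpow_nonneg (le_max_right _ _) _

@[fun_prop]
theorem Measurable.fracKernel {α : Type*} [MeasurableSpace α] {d q : ℕ} (H : Fin (d + 1) → ℝ)
    {f : α → SpaceTime d} {g : α → Fin q → SpaceTime d} (hf : Measurable f) (hg : Measurable g) :
    Measurable fun x => fracKernel q H (f x) (g x) := by
  unfold _root_.fracKernel
  fun_prop

theorem ofReal_fracKernel {d q : ℕ} (H : Fin (d + 1) → ℝ) (a : SpaceTime d)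
    (y : Fin q → SpaceTime d) : ENNReal.ofReal (fracKernel q H a y) =
      ∏ j, ∏ i, ENNReal.ofReal ((max (a i - y j i) 0) ^ (-(1 / 2 + (1 - H i) / (q : ℝ)))) := by
  rw [fracKernel, ENNReal.ofReal_prod_of_nonneg fun _ _ => Finset.prod_nonneg fun _ _ =>
    Real.rpow_nonneg (le_max_right _ _) _]
  exact Finset.prod_congr rfl fun j _ => ENNReal.ofReal_prod_of_nonneg fun i _ =>
    Real.rpow_nonneg (le_max_right _ _) _

theorem ae_forall_ne {d : ℕ} (b : SpaceTime d) : ∀ᵐ a : SpaceTime d, ∀ i, a i ≠ b i := by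
  rw [ae_all_iff]
  intro i
  rw [ae_iff]
  simpa [volume_pi] using Measure.pi_hyperplane (fun _ : Fin (d + 1) =>
      (volume : Measure ℝ)) i (b i)

/-- The inner product in `L²((ℝ^{d+1})^q)` of the kernels at `a` and `b` is of the order of the
covariance density at `(a,b)`: the exponent `1 - 2γ_i = (2H_i-2)/q` appears `q` times. -/
theorem exists_lintegral_fracKernel_mul_le {d q : ℕ} (hq : 1 ≤ q) {H : Fin (d + 1) → ℝ}
    (hH : ∀ i, H i ∈ Set.Ioo (1 / 2 : ℝ) 1) :
    ∃ C : ℝ≥0∞, C ≠ ∞ ∧ ∀ a b : SpaceTime d, (∀ i, a i ≠ b i) →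
      ∫⁻ y : Fin q → SpaceTime d,
        ENNReal.ofReal (fracKernel q H a y) * ENNReal.ofReal (fracKernel q H b y) ≤
      C * hurstKernel H a b := by
  have hq0 : (0 : ℝ) < q := by exact_mod_cast hq
  have hq1 : (1 : ℝ) ≤ q := by exact_mod_cast hq
  set γ : Fin (d + 1) → ℝ := fun i => 1 / 2 + (1 - H i) / (q : ℝ) with hγ
  have hγ1 : ∀ i, 1 / 2 < γ i := fun i => by
    have := (hH i).2
    have : 0 < (1 - H i) / (q : ℝ) := div_pos (by linarith) hq0
    simp only [hγ]; linarith
  have hγ2 : ∀ i, γ i < 1 := fun i => by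
    have h1 := (hH i).1
    have h2 := (hH i).2
    have : (1 - H i) / (q : ℝ) ≤ 1 - H i := div_le_self (by linarith) hq1
    simp only [hγ]; linarith
  set β : Fin (d + 1) → ℝ≥0∞ := fun i => ENNReal.ofReal (1 / (1 - γ i) + 1 / (2 * γ i - 1)) with hβ
  refine ⟨∏ _j : Fin q, ∏ i, β i, ENNReal.prod_ne_top fun _ _ => ENNReal.prod_ne_top fun _ _ =>
    ENNReal.ofReal_ne_top, fun a b hab => ?_⟩
  have e1 : ∀ y : Fin q → SpaceTime d,
      ENNReal.ofReal (fracKernel q H a y) * ENNReal.ofReal (fracKernel q H b y) =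
      ∏ j, ∏ i, (ENNReal.ofReal ((max (a i - y j i) 0) ^ (-γ i)) *
        ENNReal.ofReal ((max (b i - y j i) 0) ^ (-γ i))) := by
    intro y
    simp only [ofReal_fracKernel, Finset.prod_mul_distrib, hγ]
  simp_rw [e1]
  rw [volume_pi, lintegral_pi_prod (fun _ => volume) (fun _ (y : SpaceTime d) =>
      ∏ i, (ENNReal.ofReal ((max (a i - y i) 0) ^ (-γ i)) *
        ENNReal.ofReal ((max (b i - y i) 0) ^ (-γ i)))) (fun _ => by fun_prop)]
  have e2 : hurstKernel H a b = ∏ _j : Fin q, ∏ i,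
      ENNReal.ofReal (|a i - b i| ^ (1 - 2 * γ i)) := by
    rw [Finset.prod_comm, hurstKernel]
    refine Finset.prod_congr rfl fun i _ => ?_
    rw [Finset.prod_const, Finset.card_univ, Fintype.card_fin, ← ENNReal.ofReal_pow (by positivity),
      ← Real.rpow_mul_natCast (abs_nonneg _)]
    congr 2
    simp only [hγ]
    field_simp
    ring
  rw [e2, ← Finset.prod_mul_distrib]
  refine Finset.prod_le_prod' fun j _ => ?_
  rw [volume_pi, lintegral_pi_prod (fun _ => volume) (fun i (y : ℝ) =>
      (ENNReal.ofReal ((max (a i - y) 0) ^ (-γ i)) *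
        ENNReal.ofReal ((max (b i - y) 0) ^ (-γ i)))) (fun _ =>
            by fun_prop), ← Finset.prod_mul_distrib]
  exact Finset.prod_le_prod' fun i _ => lintegral_max_rpow_mul_le (hγ1 i) (hγ2 i) (hab i)

/-- The energy `∬ g(a) g(b) ∏_i |a_i - b_i|^{2H_i-2} da db` of a nonnegative function. -/
noncomputable def energy {d : ℕ} (H : Fin (d + 1) → ℝ) (g : SpaceTime d → ℝ≥0∞) : ℝ≥0∞ :=
  ∫⁻ b, ∫⁻ a, g a * g b * hurstKernel H a b

/-- Tonelli turns the squared norm of `∫ g(a) K(a;·) da` into the double integral of `g(a) g(b)`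
against the inner products of the kernels. -/
theorem exists_lintegral_sq_transfer_le {d q : ℕ} (hq : 1 ≤ q) {H : Fin (d + 1) → ℝ}
    (hH : ∀ i, H i ∈ Set.Ioo (1 / 2 : ℝ) 1) :
    ∃ C : ℝ≥0∞, C ≠ ∞ ∧ ∀ g : SpaceTime d → ℝ≥0∞, Measurable g →
      ∫⁻ y : Fin q → SpaceTime d, (∫⁻ a, g a * ENNReal.ofReal (fracKernel q H a y)) ^ 2 ≤
        C * energy H g := by
  obtain ⟨C, hC, hCle⟩ := exists_lintegral_fracKernel_mul_le (q := q) hq hH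
  refine ⟨C, hC, fun g hg => ?_⟩
  have mf : Measurable fun p : (SpaceTime d) × (Fin q → SpaceTime d) =>
      g p.1 * ENNReal.ofReal (fracKernel q H p.1 p.2) := by fun_prop
  have e1 : ∀ y : Fin q → SpaceTime d, (∫⁻ a, g a * ENNReal.ofReal (fracKernel q H a y)) ^ 2 =
      ∫⁻ b, ∫⁻ a, g a * g b * (ENNReal.ofReal (fracKernel q H a y) *
          ENNReal.ofReal (fracKernel q H b y)) := by
    intro y
    rw [sq, ← lintegral_const_mul _ (by fun_prop)]
    refine lintegral_congr fun b => ?_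
    rw [← lintegral_mul_const _ (by fun_prop)]
    exact lintegral_congr fun a => by ring
  simp_rw [e1]
  rw [lintegral_lintegral_swap]
  swap
  · have : Measurable fun p : ((Fin q → SpaceTime d) × SpaceTime d) × SpaceTime d =>
        g p.2 * g p.1.2 * (ENNReal.ofReal (fracKernel q H p.2 p.1.1) *
          ENNReal.ofReal (fracKernel q H p.1.2 p.1.1)) := by fun_prop
    exact this.lintegral_prod_right'.aemeasurable
  rw [energy, ← lintegral_const_mul]
  swap
  · have : Measurable fun p : SpaceTime d × SpaceTime d =>
        g p.2 * g p.1 * hurstKernel H p.2 p.1 := by fun_prop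
    exact this.lintegral_prod_right'
  refine lintegral_mono fun b => ?_
  rw [lintegral_lintegral_swap (by fun_prop), ← lintegral_const_mul _ (by fun_prop)]
  refine lintegral_mono_ae ?_
  filter_upwards [ae_forall_ne b] with a hab
  rw [lintegral_const_mul _ (by fun_prop)]
  calc _ ≤ g a * g b * (C * hurstKernel H a b) := mul_le_mul_right (hCle a b hab) _
    _ = _ := by ring

theorem ae_integrable_mul_fracKernel {d q : ℕ} (hq : 1 ≤ q) {H : Fin (d + 1) → ℝ}
    (hH : ∀ i, H i ∈ Set.Ioo (1 / 2 : ℝ) 1) {f : SpaceTime d → ℝ} (hf : Measurable f)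
    (hE : energy H (fun a => ‖f a‖ₑ) ≠ ∞) :
    ∀ᵐ y : Fin q → SpaceTime d, Integrable fun a => f a * fracKernel q H a y := by
  obtain ⟨C, hC, hCle⟩ := exists_lintegral_sq_transfer_le (q := q) hq hH
  have h1 := (hCle _ hf.enorm).trans_lt (ENNReal.mul_lt_top hC.lt_top hE.lt_top)
  have m1 : Measurable fun y : Fin q → SpaceTime d =>
      ∫⁻ a, ‖f a‖ₑ * ENNReal.ofReal (fracKernel q H a y) := by
    have : Measurable fun p : (Fin q → SpaceTime d) × SpaceTime d =>
      ‖f p.2‖ₑ * ENNReal.ofReal (fracKernel q H p.2 p.1) := by fun_prop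
    exact this.lintegral_prod_right'
  filter_upwards [ae_lt_top (m1.pow_const 2) h1.ne] with y hy
  refine ⟨by fun_prop, ?_⟩
  rw [hasFiniteIntegral_iff_enorm]
  simp_rw [enorm_mul, Real.enorm_of_nonneg (fracKernel_nonneg H _ y)]
  by_contra h
  rw [not_lt, top_le_iff] at h
  simp [h] at hy

theorem enorm_transferKernel_le {d q : ℕ} (H : Fin (d + 1) → ℝ) (c : ℝ) (f : SpaceTime d → ℝ)
    (y : Fin q → SpaceTime d) : ‖transferKernel q H c f y‖ₑ ≤
      ‖c‖ₑ * ∫⁻ a, ‖f a‖ₑ * ENNReal.ofReal (fracKernel q H a y) := by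
  rw [transferKernel, enorm_mul]
  gcongr
  refine (enorm_integral_le_lintegral_enorm _).trans (le_of_eq ?_)
  simp_rw [enorm_mul, Real.enorm_of_nonneg (fracKernel_nonneg H _ y)]

theorem memLp_two_iff_lintegral_sq {α : Type*} [MeasurableSpace α] {μ : Measure α} {f : α → ℝ} (hf
    : AEStronglyMeasurable f μ) :
    MemLp f 2 μ ↔ ∫⁻ x, ‖f x‖ₑ ^ 2 ∂μ < ∞ := by
  rw [MemLp, eLpNorm_lt_top_iff_lintegral_rpow_enorm_lt_top two_ne_zero ENNReal.ofNat_ne_top]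
  simp [hf]

/-- The `L²` norm of the transferred kernel is controlled by the energy, with a constant that does
not depend on the integrand; this uniformity is what allows random integrands. -/
theorem exists_lintegral_sq_transferKernel_le {d q : ℕ} (hq : 1 ≤ q) {H : Fin (d + 1) → ℝ}
    (hH : ∀ i, H i ∈ Set.Ioo (1 / 2 : ℝ) 1) (c : ℝ) :
    ∃ C : ℝ≥0∞, C ≠ ∞ ∧ ∀ f : SpaceTime d → ℝ, Measurable f →
      ∫⁻ y : Fin q → SpaceTime d, ‖transferKernel q H c f y‖ₑ ^ 2 ≤
        C * energy H (fun a => ‖f a‖ₑ) := by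
  obtain ⟨C, hC, hCle⟩ := exists_lintegral_sq_transfer_le (q := q) hq hH
  refine ⟨‖c‖ₑ ^ 2 * C, ENNReal.mul_ne_top (by simp) hC, fun f hf => ?_⟩
  calc _ ≤ ∫⁻ y : Fin q → SpaceTime d,
        ‖c‖ₑ ^ 2 * (∫⁻ a, ‖f a‖ₑ * ENNReal.ofReal (fracKernel q H a y)) ^ 2 := by
        refine lintegral_mono fun y => ?_
        rw [← mul_pow]
        gcongr
        exact enorm_transferKernel_le H c f y
    _ = ‖c‖ₑ ^ 2 * ∫⁻ y : Fin q → SpaceTime d,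
          (∫⁻ a, ‖f a‖ₑ * ENNReal.ofReal (fracKernel q H a y)) ^ 2 :=
        lintegral_const_mul' _ _ (by simp)
    _ ≤ _ := by
        rw [mul_assoc]
        gcongr
        exact hCle _ hf.enorm

theorem measurable_transferKernel {α : Type*} [MeasurableSpace α] {d q : ℕ} (H : Fin (d + 1) → ℝ)
    (c : ℝ) {f : α → SpaceTime d → ℝ} (hf : Measurable (Function.uncurry f)) :
    Measurable fun z : α × (Fin q → SpaceTime d) => transferKernel q H c (f z.1) z.2 := by
  have : Measurable fun p : (α × (Fin q → SpaceTime d)) × SpaceTime d =>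
      f p.1.1 p.2 * fracKernel q H p.2 p.1.2 :=
    (hf.comp (f := fun p : (α × (Fin q → SpaceTime d)) × SpaceTime d => (p.1.1, p.2))
      (by fun_prop)).mul (by fun_prop)
  exact (this.stronglyMeasurable.integral_prod_right').measurable.const_mul c

theorem transferKernel_comp_perm {d q : ℕ} (H : Fin (d + 1) → ℝ)
    (c : ℝ) (f : SpaceTime d → ℝ) (π : Equiv.Perm (Fin q)) (y : Fin q → SpaceTime d) :
    transferKernel q H c f (y ∘ π) = transferKernel q H c f y := by
  have : ∀ a, fracKernel q H a (y ∘ π) = fracKernel q H a y := fun a =>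
    Equiv.prod_comp π fun j => ∏ i, (max (a i - y j i) 0) ^ (-(1 / 2 + (1 - H i) / (q : ℝ)))
  simp only [transferKernel, this]

/-! ### Refinement of elementary kernels -/

instance isAddHaarMeasure_volume_pi_spaceTime (d q : ℕ) :
    (volume : Measure (Fin q → SpaceTime d)).IsAddHaarMeasure := by
  have : (volume : Measure (SpaceTime d)).IsAddHaarMeasure := isAddHaarMeasure_volume_pi _
  rw [volume_pi]
  infer_instance

/-- The multilinear expansion behind refinement: it applies to the function of a kernel (with
indicators for `g`) and to its multiple integral (with values of the noise for `g`). -/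
theorem sum_mul_prod_sum {q : ℕ} {ι κ : Type*} [Fintype ι] [Fintype κ] (c : (Fin q → ι) → ℝ)
    (m : ι → κ → ℝ) (g : Fin q → κ → ℝ) :
    ∑ i, c i * ∏ j, ∑ l, m (i j) l * g j l =
      ∑ i' : Fin q → κ, (∑ i, c i * ∏ j, m (i j) (i' j)) * ∏ j, g j (i' j) := by
  classical
  simp_rw [Finset.prod_univ_sum, Fintype.piFinset_univ, Finset.prod_mul_distrib, Finset.mul_sum,
    Finset.sum_mul]
  rw [Finset.sum_comm]
  simp_rw [mul_assoc]

namespace ElementaryKernel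

variable {d q : ℕ}

/-- Rewriting an elementary kernel on a family `B` of disjoint cells, where the weight `m k l` says
whether the cell `B_l` is a part of `A_k`. -/
noncomputable def refine (e : ElementaryKernel d q) {N : ℕ} (B : Fin N → Set (SpaceTime d))
    (hB : ∀ l, BddBorel (B l)) (hdisj : ∀ k l, k ≠ l → Disjoint (B k) (B l))
    (m : Fin e.n → Fin N → ℝ) (hm : ∀ k k' l, k ≠ k' → m k l * m k' l = 0) :
    ElementaryKernel d q where
  n := N
  A := B
  coeff i' := ∑ i, e.coeff i * ∏ j, m (i j) (i' j)
  bddBorel := hB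
  disjoint := hdisj
  diag i' hi' := by
    obtain ⟨j, k, hjk, hne⟩ : ∃ j k, i' j = i' k ∧ j ≠ k := by
      simpa [Function.Injective] using hi'
    refine Finset.sum_eq_zero fun i _ => ?_
    by_cases hij : i j = i k
    · rw [e.diag i fun h => hne (h hij), zero_mul]
    · have : (∏ j, m (i j) (i' j)) = 0 := by
        rw [← Finset.mul_prod_erase _ _ (Finset.mem_univ j),
          ← Finset.mul_prod_erase _ _ (Finset.mem_erase.2 ⟨hne.symm, Finset.mem_univ k⟩),
          ← mul_assoc, ← hjk, hm _ _ _ hij, zero_mul]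
      rw [this, mul_zero]
  symm i' π := by
    refine Fintype.sum_equiv (Equiv.arrowCongr π (Equiv.refl _)) _ _ fun i => ?_
    have h1 : e.coeff (i ∘ π.symm) = e.coeff i := e.symm i π.symm
    have h2 : ∏ j, m (i j) ((i' ∘ π) j) = ∏ j, m ((i ∘ π.symm) j) (i' j) := by
      rw [← Equiv.prod_comp π (fun j => m ((i ∘ π.symm) j) (i' j))]
      simp
    rw [h2, ← h1]
    rfl

theorem toFun_refine (e : ElementaryKernel d q) {N : ℕ} (B : Fin N → Set (SpaceTime d)) (hB hdisj)
    (m : Fin e.n → Fin N → ℝ) (hm)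
    (h : ∀ k y, (e.A k).indicator (1 : SpaceTime d → ℝ) y = ∑ l, m k l * (B l).indicator 1 y)
    (y : Fin q → SpaceTime d) : (e.refine B hB hdisj m hm).toFun y = e.toFun y := by
  simp only [toFun, h]
  exact (sum_mul_prod_sum e.coeff m fun j l => (B l).indicator 1 (y j)).symm

theorem integral_refine (e : ElementaryKernel d q) {N : ℕ} (B : Fin N → Set (SpaceTime d)) (hB
    hdisj)
    (m : Fin e.n → Fin N → ℝ) (hm) {Ω : Type*} (W : Set (SpaceTime d) → Ω → ℝ) (ω : Ω)
    (h : ∀ k, W (e.A k) ω = ∑ l, m k l * W (B l) ω) :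
    (e.refine B hB hdisj m hm).integral W ω = e.integral W ω := by
  simp only [integral, h]
  exact (sum_mul_prod_sum e.coeff m fun _ l => W (B l) ω).symm

end ElementaryKernel

/-! ### White noise -/

theorem BddBorel.volume_ne_top {d : ℕ} {A : Set (SpaceTime d)} (hA : BddBorel A) : volume A ≠ ∞ :=
  hA.2.measure_lt_top.ne

theorem BddBorel.inter {d : ℕ} {A B : Set (SpaceTime d)} (hA : BddBorel A) (hB : BddBorel B) :
    BddBorel (A ∩ B) := ⟨hA.1.inter hB.1, hA.2.subset Set.inter_subset_left⟩

theorem BddBorel.integral_indicator_mul {d : ℕ} {A B : Set (SpaceTime d)} (hA : BddBorel A)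
    (hB : BddBorel B) :
    Integrable (fun a => A.indicator (1 : SpaceTime d → ℝ) a * B.indicator 1 a) ∧
    ∫ a, A.indicator (1 : SpaceTime d → ℝ) a * B.indicator 1 a = (volume (A ∩ B)).toReal := by
  have : (fun a => A.indicator (1 : SpaceTime d → ℝ) a * B.indicator 1 a) =
      (A ∩ B).indicator 1 := by
    rw [Set.inter_indicator_one]; rfl
  rw [this]
  refine ⟨?_, ?_⟩
  · exact (integrable_indicator_iff (hA.1.inter hB.1)).2
      (integrableOn_const (C := (1 : ℝ)) (hA.inter hB).volume_ne_top)
  · rw [integral_indicator_one (hA.1.inter hB.1)]; rfl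

namespace IsWhiteNoise

variable {d : ℕ} {Ω : Type*} [MeasurableSpace Ω] {P : Measure Ω} {W : Set (SpaceTime d) → Ω → ℝ}

theorem memLp (hW : IsWhiteNoise P W) {A : Set (SpaceTime d)} (hA : BddBorel A) {p : ℝ≥0∞}
    (hp : p ≠ ∞) : MemLp (W A) p P :=
  (hW.gaussian.hasGaussianLaw_eval ⟨A, hA⟩).memLp hp

theorem integrable_mul (hW : IsWhiteNoise P W) {A B : Set (SpaceTime d)} (hA : BddBorel A)
    (hB : BddBorel B) : Integrable (fun ω => W A ω * W B ω) P :=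
  (hW.memLp hA (p := 2) (by simp)).integrable_mul (hW.memLp hB (p := 2) (by simp))

/-- The Wiener isometry for simple functions, whose sets need not be disjoint. -/
theorem integral_sum_sq (hW : IsWhiteNoise P W) {ι : Type*} [Fintype ι] (r : ι → ℝ)
    (B : ι → Set (SpaceTime d)) (hB : ∀ l, BddBorel (B l)) :
    ∫ ω, (∑ l, r l * W (B l) ω) ^ 2 ∂P =
      ∫ a, (∑ l, r l * (B l).indicator (1 : SpaceTime d → ℝ) a) ^ 2 := by
  have e1 : ∀ x : ι → ℝ, (∑ l, r l * x l) ^ 2 = ∑ k, ∑ l, r k * r l * (x k * x l) := fun x => by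
    rw [sq, Finset.sum_mul_sum]
    exact Finset.sum_congr rfl fun k _ => Finset.sum_congr rfl fun l _ => by ring
  simp_rw [e1]
  have h1 := fun k l => hW.integrable_mul (hB k) (hB l)
  have h2 := fun k l => (hB k).integral_indicator_mul (hB l)
  rw [integral_finsetSum _ fun k _ => integrable_finsetSum _ fun l _ => (h1 k l).const_mul _,
    integral_finsetSum _ fun k _ => integrable_finsetSum _ fun l _ => (h2 k l).1.const_mul _]
  refine Finset.sum_congr rfl fun k _ => ?_
  rw [integral_finsetSum _ fun l _ => (h1 k l).const_mul _,
    integral_finsetSum _ fun l _ => (h2 k l).1.const_mul _]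
  refine Finset.sum_congr rfl fun l _ => ?_
  rw [integral_const_mul, integral_const_mul, (h2 k l).2, hW.cov _ _ (hB k) (hB l)]

/-- White noise is almost surely additive: a linear relation between indicators holds for the noise,
since by the isometry the difference of its sides has second moment `0`. -/
theorem ae_eq_sum (hW : IsWhiteNoise P W) {ι : Type*} [Fintype ι] (r : ι → ℝ)
    (B : ι → Set (SpaceTime d)) (hB : ∀ l, BddBorel (B l)) {A : Set (SpaceTime d)} (hA : BddBorel A)
    (h : ∀ a, A.indicator (1 : SpaceTime d → ℝ) a = ∑ l, r l * (B l).indicator 1 a) :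
    ∀ᵐ ω ∂P, W A ω = ∑ l, r l * W (B l) ω := by
  -- the index `none` carries `-1_A`
  have key := hW.integral_sum_sq (fun o : Option ι => o.elim (-1) r) (fun o => o.elim A B)
    (fun o => by cases o <;> simp [hA, hB])
  simp only [Fintype.sum_option, Option.elim_none, Option.elim_some, ← h] at key
  simp only [neg_mul, one_mul, neg_add_cancel, ne_eq, OfNat.ofNat_ne_zero, not_false_eq_true,
    zero_pow, integral_zero] at key
  have hL : MemLp (fun ω => -W A ω + ∑ l, r l * W (B l) ω) 2 P :=
    (hW.memLp hA (by simp)).neg.add (memLp_finsetSum _ fun l _ =>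
        (hW.memLp (hB l) (by simp)).const_mul _)
  rw [integral_eq_zero_iff_of_nonneg (fun ω => sq_nonneg _) hL.integrable_sq] at key
  filter_upwards [key] with ω hω
  have : -W A ω + ∑ l, r l * W (B l) ω = 0 := by simpa using hω
  linarith

end IsWhiteNoise

theorem BddBorel.iUnion {d n : ℕ} {A : Fin n → Set (SpaceTime d)} (hA : ∀ k, BddBorel (A k)) :
    BddBorel (⋃ k, A k) :=
  ⟨MeasurableSet.iUnion fun k => (hA k).1, (Bornology.isBounded_iUnion).2 fun k => (hA k).2⟩

namespace ElementaryKernel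

variable {d q : ℕ}

/-- The partition of space-time into the cells `A_k` of a kernel and the complement of their union,
which has index `none`. -/
def part (e : ElementaryKernel d q) : Option (Fin e.n) → Set (SpaceTime d)
  | none => (⋃ k, e.A k)ᶜ
  | some k => e.A k

theorem measurableSet_part (e : ElementaryKernel d q) (o : Option (Fin e.n)) :
    MeasurableSet (e.part o) := by
  cases o with
  | none => exact (BddBorel.iUnion e.bddBorel).1.compl
  | some k => exact (e.bddBorel k).1

theorem disjoint_part (e : ElementaryKernel d q) {o o' : Option (Fin e.n)} (h : o ≠ o') :
    Disjoint (e.part o) (e.part o') := by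
  cases o with
  | none =>
    cases o' with
    | none => exact absurd rfl h
    | some k => exact (Set.disjoint_compl_left_iff_subset).2 (Set.subset_iUnion e.A k)
  | some l =>
    cases o' with
    | none => exact (Set.disjoint_compl_right_iff_subset).2 (Set.subset_iUnion e.A l)
    | some k => exact e.disjoint l k fun hlk => h (congrArg some hlk)

theorem exists_mem_part (e : ElementaryKernel d q) (a : SpaceTime d) : ∃ o, a ∈ e.part o := by
  by_cases h : ∃ k, a ∈ e.A k
  · obtain ⟨k, hk⟩ := h
    exact ⟨some k, hk⟩
  · exact ⟨none, by simpa [part] using h⟩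

/-- The cells of the common refinement of two elementary kernels. The intersection with the union of
all cells keeps them bounded; it makes the cell `(none, none)` empty. -/
def commonPart (e e' : ElementaryKernel d q) (l : Option (Fin e.n) × Option (Fin e'.n)) :
    Set (SpaceTime d) :=
  e.part l.1 ∩ e'.part l.2 ∩ ((⋃ k, e.A k) ∪ ⋃ k, e'.A k)

theorem bddBorel_commonPart (e e' : ElementaryKernel d q) (l) : BddBorel (commonPart e e' l) := by
  have h1 := BddBorel.iUnion e.bddBorel
  have h2 := BddBorel.iUnion e'.bddBorel
  exact ⟨((e.measurableSet_part _).inter (e'.measurableSet_part _)).inter (h1.1.union h2.1),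
    (h1.2.union h2.2).subset Set.inter_subset_right⟩

theorem disjoint_commonPart (e e' : ElementaryKernel d q) {l l'} (h : l ≠ l') :
    Disjoint (commonPart e e' l) (commonPart e e' l') := by
  rw [Set.disjoint_left]
  intro a ha ha'
  by_cases h1 : l.1 = l'.1
  · have h2 : l.2 ≠ l'.2 := fun h2 => h (Prod.ext h1 h2)
    exact Set.disjoint_left.1 (e'.disjoint_part h2) ha.1.2 ha'.1.2
  · exact Set.disjoint_left.1 (e.disjoint_part h1) ha.1.1 ha'.1.1

theorem indicator_eq_sum_commonPart (e e' : ElementaryKernel d q) (a : SpaceTime d) :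
    (∀ k, (e.A k).indicator (1 : SpaceTime d → ℝ) a =
      ∑ l, (if l.1 = some k then 1 else 0) * (commonPart e e' l).indicator 1 a) ∧
    (∀ k, (e'.A k).indicator (1 : SpaceTime d → ℝ) a =
      ∑ l, (if l.2 = some k then 1 else 0) * (commonPart e e' l).indicator 1 a) := by
  obtain ⟨o, ho⟩ := e.exists_mem_part a
  obtain ⟨o', ho'⟩ := e'.exists_mem_part a
  have other : ∀ l, l ≠ (o, o') → (commonPart e e' l).indicator (1 : SpaceTime d → ℝ) a = 0 := by
    intro l hl
    refine Set.indicator_of_notMem (fun ha => ?_) _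
    by_cases h1 : l.1 = o
    · have h2 : l.2 ≠ o' := fun h2 => hl (Prod.ext h1 h2)
      exact Set.disjoint_left.1 (e'.disjoint_part h2) ha.1.2 ho'
    · exact Set.disjoint_left.1 (e.disjoint_part h1) ha.1.1 ho
  refine ⟨fun k => ?_, fun k => ?_⟩
  · rw [Finset.sum_eq_single (o, o') (fun l _ hl => by rw [other l hl, mul_zero]) (by simp)]
    by_cases hk : a ∈ e.A k
    · have hok : o = some k := by
        by_contra h
        exact Set.disjoint_left.1 (e.disjoint_part h) ho hk
      have hm : a ∈ commonPart e e' (o, o') := ⟨⟨ho, ho'⟩, Or.inl (Set.mem_iUnion.2 ⟨k, hk⟩)⟩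
      subst hok
      simp [Set.indicator_of_mem hk, Set.indicator_of_mem hm]
    · have hok : o ≠ some k := fun h => hk (by rw [h] at ho; exact ho)
      simp [Set.indicator_of_notMem hk, hok]
  · rw [Finset.sum_eq_single (o, o') (fun l _ hl => by rw [other l hl, mul_zero]) (by simp)]
    by_cases hk : a ∈ e'.A k
    · have hok : o' = some k := by
        by_contra h
        exact Set.disjoint_left.1 (e'.disjoint_part h) ho' hk
      have hm : a ∈ commonPart e e' (o, o') := ⟨⟨ho, ho'⟩, Or.inr (Set.mem_iUnion.2 ⟨k, hk⟩)⟩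
      subst hok
      simp [Set.indicator_of_mem hk, Set.indicator_of_mem hm]
    · have hok : o' ≠ some k := fun h => hk (by rw [h] at ho'; exact ho')
      simp [Set.indicator_of_notMem hk, hok]

/-- The difference of two elementary kernels is elementary, and its multiple integral is the
difference of theirs: both kernels are rewritten on the cells of their common refinement. -/
theorem exists_sub (e e' : ElementaryKernel d q) {Ω : Type*} [MeasurableSpace Ω] {P : Measure Ω}
    {W : Set (SpaceTime d) → Ω → ℝ} (hW : IsWhiteNoise P W) :
    ∃ r : ElementaryKernel d q, (∀ y, r.toFun y = e.toFun y - e'.toFun y) ∧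
      ∀ᵐ ω ∂P, r.integral W ω = e.integral W ω - e'.integral W ω := by
  classical
  set κ := Option (Fin e.n) × Option (Fin e'.n)
  let eqv : κ ≃ Fin (Fintype.card κ) := Fintype.equivFin κ
  let B : Fin (Fintype.card κ) → Set (SpaceTime d) := fun l => commonPart e e' (eqv.symm l)
  have hB : ∀ l, BddBorel (B l) := fun l => bddBorel_commonPart e e' _
  have hdisj : ∀ k l, k ≠ l → Disjoint (B k) (B l) := fun k l h =>
    disjoint_commonPart e e' fun h' => h (eqv.symm.injective h')
  let m : Fin e.n → Fin (Fintype.card κ) → ℝ := fun k l => if (eqv.symm l).1 = some k then 1 else 0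
  let m' : Fin e'.n → Fin (Fintype.card κ) → ℝ :=
      fun k l => if (eqv.symm l).2 = some k then 1 else 0
  have hm : ∀ k k' l, k ≠ k' → m k l * m k' l = 0 := by
    intro k k' l h
    by_cases h1 : (eqv.symm l).1 = some k
    · have : (eqv.symm l).1 ≠ some k' := fun h2 => h (Option.some_injective _ (h1.symm.trans h2))
      simp [m, this]
    · simp [m, h1]
  have hm' : ∀ k k' l, k ≠ k' → m' k l * m' k' l = 0 := by
    intro k k' l h
    by_cases h1 : (eqv.symm l).2 = some k
    · have : (eqv.symm l).2 ≠ some k' := fun h2 => h (Option.some_injective _ (h1.symm.trans h2))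
      simp [m', this]
    · simp [m', h1]
  have h : ∀ k a, (e.A k).indicator (1 : SpaceTime d → ℝ) a = ∑ l, m k l * (B l).indicator 1 a := by
    intro k a
    rw [(indicator_eq_sum_commonPart e e' a).1 k, ← Equiv.sum_comp eqv.symm]
  have h' : ∀ k a, (e'.A k).indicator (1 : SpaceTime d → ℝ) a = ∑ l,
      m' k l * (B l).indicator 1 a := by
    intro k a
    rw [(indicator_eq_sum_commonPart e e' a).2 k, ← Equiv.sum_comp eqv.symm]
  let r := e.refine B hB hdisj m hm
  let r' := e'.refine B hB hdisj m' hm'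
  refine ⟨⟨Fintype.card κ, B, fun i => r.coeff i - r'.coeff i, hB, hdisj,
    fun i hi => by rw [r.diag i hi, r'.diag i hi, sub_zero],
    fun i π => congrArg₂ (· - ·) (r.symm i π) (r'.symm i π)⟩, fun y => ?_, ?_⟩
  · rw [← toFun_refine e B hB hdisj m hm h, ← toFun_refine e' B hB hdisj m' hm' h']
    simp only [toFun, sub_mul]
    exact Finset.sum_sub_distrib _ _
  · filter_upwards [ae_all_iff.2 fun k => hW.ae_eq_sum (m k) B hB (e.bddBorel k) (h k),
      ae_all_iff.2 fun k => hW.ae_eq_sum (m' k) B hB (e'.bddBorel k) (h' k)] with ω h1 h2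
    rw [← integral_refine e B hB hdisj m hm W ω h1, ← integral_refine e' B hB hdisj m' hm' W ω h2]
    simp only [integral, sub_mul]
    exact Finset.sum_sub_distrib _ _

end ElementaryKernel

/-! ### The bound for multiple integrals of elementary kernels -/

namespace IsWhiteNoise

variable {d : ℕ} {Ω : Type*} [MeasurableSpace Ω] {P : Measure Ω} {W : Set (SpaceTime d) → Ω → ℝ}

theorem iIndepFun (hW : IsWhiteNoise P W) {n : ℕ} {A : Fin n → Set (SpaceTime d)}
    (hA : ∀ k, BddBorel (A k)) (hdisj : ∀ k l, k ≠ l → Disjoint (A k) (A l)) :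
    ProbabilityTheory.iIndepFun (fun k => W (A k)) P := by
  have hP : IsProbabilityMeasure P := hW.gaussian.isProbabilityMeasure
  have h := IsGaussianProcess.iIndepFun_of_covariance_eq_zero (S := fun _ : Fin n => Unit)
    (X := fun k _ => W (A k)) (P := P)
    (hW.gaussian.comp_right fun p : (_ : Fin n) × Unit => ⟨A p.1, hA p.1⟩)
    (fun k _ => (hW.measurable _ (hA k)).aemeasurable) ?_
  · exact h.comp (fun _ x => x ()) fun _ => measurable_pi_apply _
  · intro k l hkl _ _
    rw [covariance_eq_sub (hW.memLp (hA k) (by simp)) (hW.memLp (hA l) (by simp)),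
      hW.mean _ (hA k), hW.mean _ (hA l)]
    have := hW.cov _ _ (hA k) (hA l)
    rw [(hdisj k l hkl).inter_eq, measure_empty, ENNReal.toReal_zero] at this
    simpa using this

theorem memLp_one_add_norm_pow (hW : IsWhiteNoise P W) {n : ℕ} {A : Fin n → Set (SpaceTime d)}
    (hA : ∀ k, BddBorel (A k)) (m : ℕ) :
    MemLp (fun ω => (1 + ‖fun k => W (A k) ω‖) ^ m) 2 P := by
  have hP : IsProbabilityMeasure P := hW.gaussian.isProbabilityMeasure
  have h0 : ∀ N : ℕ, MemLp (fun ω => 1 + ‖fun k => W (A k) ω‖) N P := by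
    intro N
    have hv : MemLp (fun ω => fun k => W (A k) ω) N P :=
      MemLp.of_eval fun k => hW.memLp (hA k) (ENNReal.natCast_ne_top N)
    exact (memLp_const (1 : ℝ)).add hv.norm
  have h1 := h0 (2 * (m + 1))
  have hs : ∀ r : ℕ, AEStronglyMeasurable (fun ω => (1 + ‖fun k => W (A k) ω‖) ^ r) P :=
    fun r => h1.aestronglyMeasurable.pow r
  have h2 := h1.integrable_norm_pow (by simp)
  have h3 : MemLp (fun ω => (1 + ‖fun k => W (A k) ω‖) ^ (m + 1)) 2 P := by
    rw [memLp_two_iff_integrable_sq (hs _)]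
    refine h2.congr (ae_of_all _ fun ω => ?_)
    have h0 : 0 ≤ 1 + ‖fun k => W (A k) ω‖ := by positivity
    change ‖1 + ‖fun k => W (A k) ω‖‖ ^ (2 * (m + 1)) = ((1 + ‖fun k => W (A k) ω‖) ^ (m + 1)) ^ 2
    rw [Real.norm_of_nonneg h0, ← pow_mul, mul_comm 2]
  refine h3.mono (hs _) (ae_of_all _ fun ω => ?_)
  rw [Real.norm_of_nonneg (by positivity), Real.norm_of_nonneg (by positivity)]
  exact pow_le_pow_right₀ (by linarith [norm_nonneg fun k => W (A k) ω]) (Nat.le_succ m)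

theorem memLp_prod (hW : IsWhiteNoise P W) {n q : ℕ} {A : Fin n → Set (SpaceTime d)}
    (hA : ∀ k, BddBorel (A k)) (i : Fin q → Fin n) :
    MemLp (fun ω => ∏ j, W (A (i j)) ω) 2 P := by
  have hm := fun k => hW.measurable _ (hA k)
  refine (hW.memLp_one_add_norm_pow hA q).mono (by fun_prop) (ae_of_all _ fun ω => ?_)
  rw [Real.norm_of_nonneg (r := (1 + ‖fun k => W (A k) ω‖) ^ q) (by positivity), norm_prod]
  refine (Finset.prod_le_prod (fun _ _ => norm_nonneg _) fun j _ =>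
    (norm_le_pi_norm (fun k => W (A k) ω) (i j)).trans (le_add_of_nonneg_left zero_le_one)).trans ?_
  simp

/-- Products of the noise over distinct cells are orthogonal unless they run over the same cells:
a cell in only one of the two products contributes a factor `E[W(A_k)] = 0`. -/
theorem integral_prod_mul_prod (hW : IsWhiteNoise P W) {n q : ℕ} {A : Fin n → Set (SpaceTime d)}
    (hA : ∀ k, BddBorel (A k)) (hdisj : ∀ k l, k ≠ l → Disjoint (A k) (A l))
    {i i' : Fin q → Fin n} (hi : i.Injective) (hi' : i'.Injective) :
    ∫ ω, (∏ j, W (A (i j)) ω) * ∏ j, W (A (i' j)) ω ∂P =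
      if Finset.univ.image i = Finset.univ.image i' then ∏ j, (volume (A (i j))).toReal else 0 := by
  classical
  have hP : IsProbabilityMeasure P := hW.gaussian.isProbabilityMeasure
  have hprod : ∀ (i : Fin q → Fin n) (_ : i.Injective) (w : Fin n → ℝ),
      ∏ j, w (i j) = ∏ k, if k ∈ Finset.univ.image i then w k else 1 := by
    intro i hi w
    rw [Finset.prod_ite_mem, Finset.univ_inter, Finset.prod_image fun _ _ _ _ h => hi h]
  have hsq : ∀ k, ∫ ω, W (A k) ω * W (A k) ω ∂P = (volume (A k)).toReal := fun k => by
    rw [hW.cov _ _ (hA k) (hA k), Set.inter_self]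
  have e1 : ∀ ω, (∏ j, W (A (i j)) ω) * ∏ j, W (A (i' j)) ω =
      ∏ k, (fun x => (if k ∈ Finset.univ.image i then x else 1) *
        if k ∈ Finset.univ.image i' then x else 1) (W (A k) ω) := by
    intro ω
    rw [hprod i hi fun k => W (A k) ω, hprod i' hi' fun k => W (A k) ω, ← Finset.prod_mul_distrib]
  simp_rw [e1]
  rw [(hW.iIndepFun hA hdisj).integral_fun_prod_comp (fun k =>
      (hW.measurable _ (hA k)).aemeasurable)
    (f := fun k x => (if k ∈ Finset.univ.image i then x else 1) *
        if k ∈ Finset.univ.image i' then x else 1)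
    fun k => by split_ifs <;> fun_prop]
  split_ifs with h
  · rw [hprod i hi fun k => (volume (A k)).toReal, ← h]
    refine Finset.prod_congr rfl fun k _ => ?_
    split_ifs
    · exact hsq k
    · simp
  · obtain ⟨k, hk⟩ : ∃ k, ¬(k ∈ Finset.univ.image i ↔ k ∈ Finset.univ.image i') := by
      by_contra! hc
      exact h (Finset.ext hc)
    refine Finset.prod_eq_zero (Finset.mem_univ k) ?_
    by_cases h1 : k ∈ Finset.univ.image i <;> by_cases h2 : k ∈ Finset.univ.image i'
    · exact absurd (iff_of_true h1 h2) hk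
    · simp only [h1, h2, if_true, if_false, mul_one]
      exact hW.mean _ (hA k)
    · simp only [h1, h2, if_true, if_false, one_mul]
      exact hW.mean _ (hA k)
    · exact absurd (iff_of_false h1 h2) hk

end IsWhiteNoise

theorem MeasureTheory.MemLp.eLpNorm_two_eq_sqrt {α : Type*} [MeasurableSpace α] {μ : Measure α} {f
    : α → ℝ}
    (hf : MemLp f 2 μ) : eLpNorm f 2 μ = ENNReal.ofReal √(∫ x, f x ^ 2 ∂μ) := by
  rw [hf.eLpNorm_eq_integral_rpow_norm two_ne_zero ENNReal.ofNat_ne_top, Real.sqrt_eq_rpow]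
  simp

namespace ElementaryKernel

variable {d q : ℕ}

theorem injective_of_coeff_ne_zero (e : ElementaryKernel d q) {i : Fin q → Fin e.n}
    (h : e.coeff i ≠ 0) : i.Injective := by
  by_contra hi
  exact h (e.diag i hi)

theorem toFun_sq (e : ElementaryKernel d q) (y : Fin q → SpaceTime d) :
    e.toFun y ^ 2 = ∑ i, e.coeff i ^ 2 * ∏ j,
        (e.A (i j)).indicator (1 : SpaceTime d → ℝ) (y j) := by
  classical
  have key : ∀ i i' : Fin q → Fin e.n,
      (∏ j, (e.A (i j)).indicator (1 : SpaceTime d → ℝ) (y j)) * ∏ j,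
          (e.A (i' j)).indicator 1 (y j) =
      if i = i' then ∏ j, (e.A (i j)).indicator (1 : SpaceTime d → ℝ) (y j) else 0 := by
    intro i i'
    rw [← Finset.prod_mul_distrib]
    split_ifs with h
    · subst h
      refine Finset.prod_congr rfl fun j _ => ?_
      by_cases hj : y j ∈ e.A (i j) <;> simp [hj]
    · obtain ⟨j, hj⟩ := Function.ne_iff.1 h
      refine Finset.prod_eq_zero (Finset.mem_univ j) ?_
      by_cases h1 : y j ∈ e.A (i j)
      · have h2 : y j ∉ e.A (i' j) := Set.disjoint_left.1 (e.disjoint _ _ hj) h1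
        simp [h2]
      · simp [h1]
  rw [sq, toFun, Finset.sum_mul_sum]
  refine Finset.sum_congr rfl fun i _ => ?_
  have : ∀ i', e.coeff i * (∏ j, (e.A (i j)).indicator (1 : SpaceTime d → ℝ) (y j)) *
      (e.coeff i' * ∏ j, (e.A (i' j)).indicator 1 (y j)) =
      if i = i' then e.coeff i ^ 2 * ∏ j,
          (e.A (i j)).indicator (1 : SpaceTime d → ℝ) (y j) else 0 := by
    intro i'
    rw [mul_mul_mul_comm, key]
    split_ifs with h
    · rw [h, sq]
    · rw [mul_zero]
  simp [this]

theorem measurable_toFun (e : ElementaryKernel d q) : Measurable e.toFun := by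
  unfold toFun
  refine Finset.measurable_sum _ fun i _ => (Finset.measurable_prod _ fun j _ => ?_).const_mul _
  exact (measurable_one.indicator (e.bddBorel _).1).comp (measurable_pi_apply j)

theorem integrable_prod_indicator (e : ElementaryKernel d q) (i : Fin q → Fin e.n) :
    Integrable fun y : Fin q → SpaceTime d =>
      ∏ j, (e.A (i j)).indicator (1 : SpaceTime d → ℝ) (y j) :=
  Integrable.fintype_prod (f := fun j => (e.A (i j)).indicator (1 : SpaceTime d → ℝ)) fun j =>
    (integrable_indicator_iff (e.bddBorel _).1).2
      (integrableOn_const (C := (1 : ℝ)) (e.bddBorel _).volume_ne_top)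

theorem memLp_toFun (e : ElementaryKernel d q) : MemLp e.toFun 2 := by
  rw [memLp_two_iff_integrable_sq e.measurable_toFun.aestronglyMeasurable]
  simp_rw [toFun_sq]
  exact integrable_finsetSum _ fun i _ => (e.integrable_prod_indicator i).const_mul _

theorem integral_toFun_sq (e : ElementaryKernel d q) :
    ∫ y, e.toFun y ^ 2 = ∑ i, e.coeff i ^ 2 * ∏ j, (volume (e.A (i j))).toReal := by
  simp_rw [toFun_sq]
  rw [integral_finsetSum _ fun i _ => (e.integrable_prod_indicator i).const_mul _]
  refine Finset.sum_congr rfl fun i _ => ?_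
  rw [integral_const_mul, integral_fintype_prod_volume_eq_prod
    fun j => (e.A (i j)).indicator (1 : SpaceTime d → ℝ)]
  congr 1
  refine Finset.prod_congr rfl fun j _ => ?_
  rw [integral_indicator_one (e.bddBorel _).1]; rfl

variable {Ω : Type*} [MeasurableSpace Ω] {P : Measure Ω} {W : Set (SpaceTime d) → Ω → ℝ}

theorem memLp_integral (e : ElementaryKernel d q) (hW : IsWhiteNoise P W) :
    MemLp (e.integral W) 2 P :=
  memLp_finsetSum _ fun i _ => (hW.memLp_prod e.bddBorel i).const_mul _

/-- `I_q` is bounded on elementary kernels. Only pairs of indices with the same image contribute to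
the second moment, and each image belongs to at most `q^q` indices; the crude constant `q^q` in place
of `q!` avoids the symmetry of the coefficients. -/
theorem integral_integral_sq_le (e : ElementaryKernel d q) (hW : IsWhiteNoise P W) :
    ∫ ω, e.integral W ω ^ 2 ∂P ≤ (q : ℝ) ^ q * ∫ y, e.toFun y ^ 2 := by
  classical
  set v : (Fin q → Fin e.n) → ℝ := fun i => ∏ j, (volume (e.A (i j))).toReal with hv
  have hv0 : ∀ i, 0 ≤ v i := fun i => Finset.prod_nonneg fun _ _ => ENNReal.toReal_nonneg
  have e1 : ∀ ω, e.integral W ω ^ 2 = ∑ i, ∑ i', e.coeff i * e.coeff i' *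
      ((∏ j, W (e.A (i j)) ω) * ∏ j, W (e.A (i' j)) ω) := by
    intro ω
    rw [sq, integral, Finset.sum_mul_sum]
    exact Finset.sum_congr rfl fun _ _ => Finset.sum_congr rfl fun _ _ => by ring
  have hint : ∀ i i', Integrable (fun ω => e.coeff i * e.coeff i' *
      ((∏ j, W (e.A (i j)) ω) * ∏ j, W (e.A (i' j)) ω)) P := fun i i' =>
    ((hW.memLp_prod e.bddBorel i).integrable_mul (hW.memLp_prod e.bddBorel i')).const_mul _
  simp_rw [e1]
  rw [integral_finsetSum _ fun i _ => integrable_finsetSum _ fun i' _ => hint i i',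
    integral_toFun_sq]
  simp_rw [integral_finsetSum _ fun i' _ => hint _ i', integral_const_mul]
  let S : (Fin q → Fin e.n) → (Fin q → Fin e.n) → Prop := fun i i' =>
    Finset.univ.image i = Finset.univ.image i'
  have hS : ∀ i i', S i i' ↔ S i' i := fun i i' => eq_comm
  have term : ∀ i i', e.coeff i * e.coeff i' *
      ∫ ω, (∏ j, W (e.A (i j)) ω) * ∏ j, W (e.A (i' j)) ω ∂P ≤
      (if S i i' then e.coeff i ^ 2 * v i / 2 else 0) +
      if S i' i then e.coeff i' ^ 2 * v i' / 2 else 0 := by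
    intro i i'
    have hr : 0 ≤ (if S i i' then e.coeff i ^ 2 * v i / 2 else 0) +
      if S i' i then e.coeff i' ^ 2 * v i' / 2 else 0 := by
      have := hv0 i
      have := hv0 i'
      positivity
    by_cases h : e.coeff i = 0
    · simpa [h] using hr
    by_cases h' : e.coeff i' = 0
    · simpa [h'] using hr
    have hi := e.injective_of_coeff_ne_zero h
    have hi' := e.injective_of_coeff_ne_zero h'
    rw [hW.integral_prod_mul_prod e.bddBorel e.disjoint hi hi']
    by_cases hSi : S i i'
    · have hvv : v i' = v i := by
        simp only [hv]
        rw [← Finset.prod_image (f := fun k => (volume (e.A k)).toReal) fun _ _ _ _ h => hi h,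
          ← Finset.prod_image (f := fun k => (volume (e.A k)).toReal) fun _ _ _ _ h => hi' h]
        exact congrArg (fun s => ∏ k ∈ s, (volume (e.A k)).toReal) hSi.symm
      rw [if_pos hSi, if_pos hSi, if_pos ((hS _ _).1 hSi), hvv]
      change e.coeff i * e.coeff i' * v i ≤ _
      nlinarith [mul_nonneg (sq_nonneg (e.coeff i - e.coeff i')) (hv0 i)]
    · rw [if_neg hSi, mul_zero]
      exact hr
  have card : ∀ i, ∑ i', (if S i i' then e.coeff i ^ 2 * v i / 2 else 0) ≤
      (q : ℝ) ^ q * (e.coeff i ^ 2 * v i / 2) := by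
    intro i
    rw [← Finset.sum_filter, Finset.sum_const, nsmul_eq_mul]
    refine mul_le_mul_of_nonneg_right ?_ (by have := hv0 i; positivity)
    have h1 : Finset.univ.filter (S i) ⊆ Fintype.piFinset fun _ : Fin q => Finset.univ.image i := by
      intro i' hi'
      rw [Fintype.mem_piFinset]
      intro j
      have : Finset.univ.image i = Finset.univ.image i' := (Finset.mem_filter.1 hi').2
      rw [this]
      exact Finset.mem_image_of_mem _ (Finset.mem_univ j)
    have h2 := Finset.card_le_card h1
    rw [Fintype.card_piFinset_const] at h2
    have h3 : (Finset.univ.image i).card ≤ q := Finset.card_image_le.trans (by simp)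
    exact_mod_cast h2.trans (Nat.pow_le_pow_left h3 q)
  calc _ ≤ ∑ i, ∑ i', ((if S i i' then e.coeff i ^ 2 * v i / 2 else 0) +
      if S i' i then e.coeff i' ^ 2 * v i' / 2 else 0) :=
        Finset.sum_le_sum fun i _ => Finset.sum_le_sum fun i' _ => term i i'
    _ = ∑ i, ∑ i', (if S i i' then e.coeff i ^ 2 * v i / 2 else 0) +
        ∑ i, ∑ i', (if S i i' then e.coeff i ^ 2 * v i / 2 else 0) := by
        simp_rw [Finset.sum_add_distrib]
        congr 1
        exact Finset.sum_comm
    _ ≤ ∑ i, (q : ℝ) ^ q * (e.coeff i ^ 2 * v i / 2) + ∑ i,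
        (q : ℝ) ^ q * (e.coeff i ^ 2 * v i / 2) :=
        add_le_add (Finset.sum_le_sum fun i _ => card i) (Finset.sum_le_sum fun i _ => card i)
    _ = _ := by
        rw [← Finset.sum_add_distrib, Finset.mul_sum]
        exact Finset.sum_congr rfl fun i _ => by ring

theorem eLpNorm_integral_sub_le (e e' : ElementaryKernel d q) (hW : IsWhiteNoise P W) :
    eLpNorm (fun ω => e.integral W ω - e'.integral W ω) 2 P ≤
      ENNReal.ofReal √((q : ℝ) ^ q) * eLpNorm (fun y => e.toFun y - e'.toFun y) 2 volume := by
  obtain ⟨r, hr, hrW⟩ := e.exists_sub e' hW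
  have h1 : (fun ω => e.integral W ω - e'.integral W ω) =ᵐ[P] r.integral W := by
    filter_upwards [hrW] with ω h using h.symm
  have h2 : (fun y => e.toFun y - e'.toFun y) = r.toFun := (funext hr).symm
  rw [eLpNorm_congr_ae h1, h2, (r.memLp_integral hW).eLpNorm_two_eq_sqrt,
    r.memLp_toFun.eLpNorm_two_eq_sqrt, ← ENNReal.ofReal_mul (Real.sqrt_nonneg _),
    ← Real.sqrt_mul (by positivity)]
  exact ENNReal.ofReal_le_ofReal (Real.sqrt_le_sqrt (r.integral_integral_sq_le hW))

theorem eLpNorm_integral_sub_le_add (e e' : ElementaryKernel d q) (hW : IsWhiteNoise P W)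
    {F : (Fin q → SpaceTime d) → ℝ} (hF : MemLp F 2) :
    eLpNorm (fun ω => e.integral W ω - e'.integral W ω) 2 P ≤
      ENNReal.ofReal √((q : ℝ) ^ q) * (eLpNorm (fun y => F y - e.toFun y) 2 volume +
        eLpNorm (fun y => F y - e'.toFun y) 2 volume) := by
  refine (e.eLpNorm_integral_sub_le e' hW).trans (mul_le_mul_right ?_ _)
  have h1 : (fun y => e.toFun y - e'.toFun y) =
      (fun y => F y - e'.toFun y) - fun y => F y - e.toFun y := by
    ext y; simp
  rw [h1, add_comm (eLpNorm _ _ _)]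
  exact eLpNorm_sub_le (hF.sub e'.memLp_toFun).1 (hF.sub e.memLp_toFun).1 (by norm_num)

end ElementaryKernel

/-! ### Density of the elementary kernels -/

/-- The indices of the cubes of side `1/N` that tile `[-N,N)^{d+1}`. -/
def GridIndex (d N : ℕ) : Type :=
  ↥(Fintype.piFinset fun _ : Fin (d + 1) => Finset.Ico (-((N : ℤ) ^ 2)) ((N : ℤ) ^ 2))

noncomputable instance (d N : ℕ) : Fintype (GridIndex d N) := by
  unfold GridIndex; infer_instance

/-- The index of the cube of side `1/N` that contains `a`. -/
noncomputable def gridCell {d : ℕ} (N : ℕ) (a : SpaceTime d) : Fin (d + 1) → ℤ :=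
  fun i => ⌊(N : ℝ) * a i⌋

/-- The corner of a cube of side `1/N`. -/
noncomputable def gridPoint {d : ℕ} (N : ℕ) (k : Fin (d + 1) → ℤ) : SpaceTime d :=
  fun i => (k i : ℝ) / N

theorem norm_gridPoint_sub_le {d N : ℕ} (hN : 0 < N) (a : SpaceTime d) :
    ‖gridPoint N (gridCell N a) - a‖ ≤ 1 / N := by
  have hN' : (0 : ℝ) < N := by exact_mod_cast hN
  refine (pi_norm_le_iff_of_nonneg (by positivity)).2 fun i => ?_
  have h1 := Int.floor_le ((N : ℝ) * a i)
  have h2 := Int.lt_floor_add_one ((N : ℝ) * a i)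
  simp only [gridPoint, gridCell, Pi.sub_apply, Real.norm_eq_abs]
  rw [abs_le, div_sub' hN'.ne', ← neg_div, div_le_div_iff_of_pos_right hN',
    div_le_div_iff_of_pos_right hN']
  constructor <;> linarith

theorem gridCell_mem {d N : ℕ} {a : SpaceTime d} (ha : ‖a‖ < N) :
    gridCell N a ∈ Fintype.piFinset fun _ : Fin (d + 1) =>
      Finset.Ico (-((N : ℤ) ^ 2)) ((N : ℤ) ^ 2) := by
  rw [Fintype.mem_piFinset]
  intro i
  have hN : (0 : ℝ) < N := (norm_nonneg a).trans_lt ha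
  have h := abs_lt.1 ((norm_le_pi_norm a i).trans_lt ha)
  rw [Finset.mem_Ico, gridCell, Int.le_floor, Int.floor_lt]
  push_cast
  constructor <;> nlinarith

theorem bddBorel_gridCell {d N : ℕ} (hN : 0 < N) (k : Fin (d + 1) → ℤ) :
    BddBorel {a : SpaceTime d | gridCell N a = k} := by
  refine ⟨?_, ?_⟩
  · have : Measurable (gridCell (d := d) N) := by unfold gridCell; fun_prop
    exact this (MeasurableSet.singleton k)
  · refine (Metric.isBounded_closedBall (x := gridPoint N k) (r := 1 / N)).subset fun a ha => ?_
    have ha' : gridCell N a = k := ha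
    rw [Metric.mem_closedBall, dist_comm, dist_eq_norm, ← ha']
    exact norm_gridPoint_sub_le hN a

/-- The elementary kernel that samples a symmetric function `g` at the corners of cubes of side
`1/N`; the boxes in which two of the `q` cubes coincide get the coefficient `0`. -/
noncomputable def gridKernel {d q : ℕ} (g : (Fin q → SpaceTime d) → ℝ)
    (hg : ∀ y (π : Equiv.Perm (Fin q)), g (y ∘ π) = g y) {N : ℕ} (hN : 0 < N) :
    ElementaryKernel d q := by
  classical exact
  { n := Fintype.card (GridIndex d N)
    A := fun k => {a | gridCell N a = ((Fintype.equivFin (GridIndex d N)).symm k).1}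
    coeff := fun i => if i.Injective then
      g fun j => gridPoint N ((Fintype.equivFin (GridIndex d N)).symm (i j)).1 else 0
    bddBorel := fun k => bddBorel_gridCell hN _
    disjoint := fun k l hkl => by
      rw [Set.disjoint_left]
      intro a ha hb
      have ha' : gridCell N a = ((Fintype.equivFin (GridIndex d N)).symm k).1 := ha
      have hb' : gridCell N a = ((Fintype.equivFin (GridIndex d N)).symm l).1 := hb
      exact hkl ((Fintype.equivFin (GridIndex d N)).symm.injective (Subtype.ext (ha'.symm.trans
          hb')))
    diag := fun i hi => if_neg hi
    symm := fun i π => by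
      have h1 : (i ∘ π).Injective ↔ i.Injective := π.injective_comp i
      simp only [h1]
      exact if_congr Iff.rfl (hg (fun j => gridPoint N
        ((Fintype.equivFin (GridIndex d N)).symm (i j)).1) π) rfl }

theorem ElementaryKernel.toFun_eq_coeff {d q : ℕ} (e : ElementaryKernel d q)
    {y : Fin q → SpaceTime d} {i : Fin q → Fin e.n} (h : ∀ j, y j ∈ e.A (i j)) :
    e.toFun y = e.coeff i := by
  rw [ElementaryKernel.toFun, Finset.sum_eq_single i]
  · rw [Finset.prod_eq_one fun j _ => by rw [Set.indicator_of_mem (h j), Pi.one_apply], mul_one]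
  · intro i' _ hi'
    obtain ⟨j, hj⟩ := Function.ne_iff.1 hi'
    rw [Finset.prod_eq_zero (Finset.mem_univ j), mul_zero]
    exact Set.indicator_of_notMem (fun hm => Set.disjoint_left.1 (e.disjoint _ _ hj) hm (h j)) _
  · simp

theorem ElementaryKernel.toFun_eq_zero {d q : ℕ} (e : ElementaryKernel d q)
    {y : Fin q → SpaceTime d} {j : Fin q} (h : ∀ k, y j ∉ e.A k) : e.toFun y = 0 := by
  refine Finset.sum_eq_zero fun i _ => ?_
  rw [Finset.prod_eq_zero (Finset.mem_univ j), mul_zero]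
  exact Set.indicator_of_notMem (h _) _

/-- The grid approximation at `y` is `0` or the value of `g` at the corners next to `y`, and it is the
latter if `y` lies in the grid and its components in different cubes. -/
theorem gridKernel_toFun {d q : ℕ} (g : (Fin q → SpaceTime d) → ℝ)
    (hg : ∀ y (π : Equiv.Perm (Fin q)), g (y ∘ π) = g y) {N : ℕ} (hN : 0 < N)
    (y : Fin q → SpaceTime d) :
    ((gridKernel g hg hN).toFun y = 0 ∨
      (gridKernel g hg hN).toFun y = g fun j => gridPoint N (gridCell N (y j))) ∧
    (‖y‖ < N → (fun j => gridCell N (y j)).Injective →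
      (gridKernel g hg hN).toFun y = g fun j => gridPoint N (gridCell N (y j))) := by
  classical
  by_cases h : ∀ j, gridCell N (y j) ∈ Fintype.piFinset fun _ : Fin (d + 1) =>
      Finset.Ico (-((N : ℤ) ^ 2)) ((N : ℤ) ^ 2)
  · let i : Fin q → Fin (gridKernel g hg hN).n := fun j =>
      Fintype.equivFin (GridIndex d N) ⟨gridCell N (y j), h j⟩
    have hi : ∀ j, ((Fintype.equivFin (GridIndex d N)).symm (i j)).1 = gridCell N (y j) := by
      intro j
      exact congrArg Subtype.val (Equiv.symm_apply_apply (Fintype.equivFin (GridIndex d N))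
        ⟨gridCell N (y j), h j⟩)
    have hmem : ∀ j, y j ∈ (gridKernel g hg hN).A (i j) := fun j => (hi j).symm
    have hc : (gridKernel g hg hN).coeff i =
        if i.Injective then g fun j => gridPoint N (gridCell N (y j)) else 0 := by
      simp only [gridKernel, hi]
      congr
    rw [(gridKernel g hg hN).toFun_eq_coeff hmem, hc]
    refine ⟨by split_ifs <;> simp, fun _ hinj => if_pos fun j k hjk => hinj ?_⟩
    simpa [hi] using congrArg (fun l => ((Fintype.equivFin (GridIndex d N)).symm l).1) hjk
  · push Not at h
    obtain ⟨j, hj⟩ := h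
    have h0 : (gridKernel g hg hN).toFun y = 0 :=
      (gridKernel g hg hN).toFun_eq_zero (j := j) fun k hk => hj (by
        have hk' : gridCell N (y j) = ((Fintype.equivFin (GridIndex d N)).symm k).1 := hk
        rw [hk']
        exact ((Fintype.equivFin (GridIndex d N)).symm k).2)
    exact ⟨Or.inl h0, fun hy => absurd (gridCell_mem ((norm_le_pi_norm y j).trans_lt hy)) hj⟩

/-- The diagonals of `(ℝ^{d+1})^q` are proper subspaces, hence null sets. -/
theorem ae_injective (d q : ℕ) : ∀ᵐ y : Fin q → SpaceTime d, y.Injective := by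
  have h : ∀ j k : Fin q, j ≠ k → ∀ᵐ y : Fin q → SpaceTime d, y j ≠ y k := by
    intro j k hjk
    let l : (Fin q → SpaceTime d) →ₗ[ℝ] SpaceTime d :=
      { toFun := fun y => y j - y k
        map_add' := fun y w => by simp only [Pi.add_apply]; abel
        map_smul' := fun r y => by simp [smul_sub] }
    have h0 : volume (LinearMap.ker l : Set (Fin q → SpaceTime d)) = 0 := by
      refine Measure.addHaar_submodule _ _ fun htop => ?_
      have h1 : Function.update (0 : Fin q → SpaceTime d) j 1 ∈ LinearMap.ker l := by
        rw [htop]; trivial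
      have h2 : (Function.update (0 : Fin q → SpaceTime d) j 1) j -
        (Function.update (0 : Fin q → SpaceTime d) j 1) k = 0 := h1
      rw [Function.update_self, Function.update_of_ne hjk.symm] at h2
      simpa using congrFun h2 0
    rw [ae_iff]
    refine measure_mono_null (fun y hy => ?_) h0
    have hy' : y j = y k := by simpa using hy
    change y j - y k = 0
    rw [hy', sub_self]
  have h' : ∀ᵐ y : Fin q → SpaceTime d, ∀ j k, j ≠ k → y j ≠ y k :=
    ae_all_iff.2 fun j => ae_all_iff.2 fun k => by
      by_cases hjk : j = k
      · exact ae_of_all _ fun y hne => absurd hjk hne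
      · filter_upwards [h j k hjk] with y hy _ using hy
  filter_upwards [h'] with y hy j k hjk
  by_contra hne
  exact hy j k hne hjk

theorem tendsto_gridPoint {d : ℕ} (a : SpaceTime d) :
    Tendsto (fun n : ℕ => gridPoint (n + 1) (gridCell (n + 1) a)) atTop (𝓝 a) := by
  rw [tendsto_iff_norm_sub_tendsto_zero]
  refine squeeze_zero (fun _ => norm_nonneg _) (fun n => norm_gridPoint_sub_le n.succ_pos a) ?_
  exact_mod_cast tendsto_one_div_add_atTop_nhds_zero_nat (𝕜 := ℝ)

/-- Grid approximations of a continuous symmetric function with bounded support converge in `L²`, by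
dominated convergence: off the diagonals the cubes are eventually distinct. -/
theorem tendsto_gridKernel {d q : ℕ} {g : (Fin q → SpaceTime d) → ℝ}
    (hg : ∀ y (π : Equiv.Perm (Fin q)), g (y ∘ π) = g y) (hgc : Continuous g) {R : ℝ}
    (hR : ∀ y, R < ‖y‖ → g y = 0) :
    Tendsto (fun n : ℕ => ∫⁻ y, ‖g y - (gridKernel g hg n.succ_pos).toFun y‖ₑ ^ 2) atTop (𝓝 0) := by
  obtain ⟨M, hM⟩ : ∃ M, ∀ y, ‖g y‖ ≤ M := by
    obtain ⟨M, hM⟩ := (isCompact_closedBall (0 : Fin q → SpaceTime d)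
        R).exists_bound_of_continuousOn
      hgc.continuousOn
    refine ⟨max M 0, fun y => ?_⟩
    by_cases hy : ‖y‖ ≤ R
    · exact (hM y (by simpa using hy)).trans (le_max_left _ _)
    · rw [hR y (not_le.1 hy), norm_zero]; exact le_max_right _ _
  have hM0 : 0 ≤ M := (norm_nonneg _).trans (hM 0)
  set B := Metric.closedBall (0 : Fin q → SpaceTime d) (R + 1) with hB
  have hbound : ∀ (n : ℕ) y, ‖g y - (gridKernel g hg n.succ_pos).toFun y‖ₑ ^ 2 ≤
      B.indicator (fun _ => ENNReal.ofReal (2 * M) ^ 2) y := by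
    intro n y
    have hcases := (gridKernel_toFun g hg n.succ_pos y).1
    by_cases hy : y ∈ B
    · rw [Set.indicator_of_mem hy, ← ofReal_norm]
      refine pow_le_pow_left' (ENNReal.ofReal_le_ofReal ((norm_sub_le _ _).trans ?_)) 2
      have : ‖(gridKernel g hg n.succ_pos).toFun y‖ ≤ M := by
        rcases hcases with h | h
        · rw [h, norm_zero]; exact hM0
        · rw [h]; exact hM _
      linarith [hM y]
    · have hy' : R + 1 < ‖y‖ := by simpa [hB] using hy
      have h1 : g y = 0 := hR y (by linarith)
      have h2 : (gridKernel g hg n.succ_pos).toFun y = 0 := by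
        rcases hcases with h | h
        · exact h
        · rw [h]
          apply hR
          have h3 : ‖(fun j => gridPoint (n + 1) (gridCell (n + 1) (y j))) - y‖ ≤ 1 := by
            refine (pi_norm_le_iff_of_nonneg zero_le_one).2 fun j =>
              (norm_gridPoint_sub_le n.succ_pos (y j)).trans ?_
            rw [div_le_one (by positivity)]
            exact_mod_cast Nat.succ_le_succ (Nat.zero_le n)
          have h4 := norm_sub_norm_le y fun j => gridPoint (n + 1) (gridCell (n + 1) (y j))
          rw [norm_sub_rev] at h4
          exact lt_of_lt_of_le (by linarith) (le_of_eq rfl)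
      rw [h1, h2]; simp
  have key := tendsto_lintegral_of_dominated_convergence
    (μ := (volume : Measure (Fin q → SpaceTime d)))
    (F := fun (n : ℕ) y => ‖g y - (gridKernel g hg n.succ_pos).toFun y‖ₑ ^ 2) (f := fun _ => 0)
    (B.indicator fun _ => ENNReal.ofReal (2 * M) ^ 2)
    (fun n => ((hgc.measurable.sub (gridKernel g hg n.succ_pos).measurable_toFun).enorm.pow_const
        2))
    (fun n => ae_of_all _ (hbound n)) ?_ ?_
  · simpa using key
  · rw [lintegral_indicator Metric.isClosed_closedBall.measurableSet, setLIntegral_const]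
    exact ENNReal.mul_ne_top (by finiteness) (isCompact_closedBall _ _).measure_lt_top.ne
  · filter_upwards [ae_injective d q] with y hy
    have hinj : ∀ᶠ n : ℕ in atTop, (fun j => gridCell (n + 1) (y j)).Injective := by
      have : ∀ᶠ n : ℕ in atTop, ∀ j k, j ≠ k →
          gridPoint (n + 1) (gridCell (n + 1) (y j)) ≠ gridPoint (n + 1) (gridCell (n +
              1) (y k)) := by
        refine eventually_all.2 fun j => eventually_all.2 fun k => ?_
        by_cases hjk : j = k
        · exact Eventually.of_forall fun _ hne => absurd hjk hne
        · filter_upwards [((tendsto_gridPoint (y j)).sub (tendsto_gridPoint (y k))).eventually_ne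
            (sub_ne_zero.2 fun h => hjk (hy h))] with n hn _ using sub_ne_zero.1 hn
      filter_upwards [this] with n hn j k hjk
      by_contra hne
      exact hn j k hne (congrArg (gridPoint (n + 1)) hjk)
    have hlarge : ∀ᶠ n : ℕ in atTop, ‖y‖ < (n + 1 : ℕ) := by
      filter_upwards [eventually_ge_atTop ⌈‖y‖⌉₊] with n hn
      have h1 := Nat.le_ceil ‖y‖
      have h2 : (⌈‖y‖⌉₊ : ℝ) ≤ n := by exact_mod_cast hn
      push_cast
      linarith
    have hlim : Tendsto (fun n : ℕ => ‖g y - g fun j =>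
        gridPoint (n + 1) (gridCell (n + 1) (y j))‖ₑ ^ 2)
        atTop (𝓝 0) := by
      have h1 : Tendsto (fun n : ℕ => fun j =>
          gridPoint (n + 1) (gridCell (n + 1) (y j))) atTop (𝓝 y) :=
        tendsto_pi_nhds.2 fun j => tendsto_gridPoint (y j)
      have h2 : Continuous fun w => ‖g y - g w‖ₑ ^ 2 := by fun_prop
      rw [show (0 : ℝ≥0∞) = ‖g y - g y‖ₑ ^ 2 by simp]
      exact (h2.tendsto y).comp h1
    refine hlim.congr' ?_
    filter_upwards [hinj, hlarge] with n h1 h2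
    rw [(gridKernel_toFun g hg n.succ_pos y).2 h2 h1]

theorem measurePreserving_comp_perm {d q : ℕ} (π : Equiv.Perm (Fin q)) :
    MeasurePreserving (fun y : Fin q → SpaceTime d => y ∘ π) volume volume := by
  have h := volume_measurePreserving_piCongrLeft (fun _ : Fin q => SpaceTime d) π.symm
  convert h using 1
  ext y j
  have := MeasurableEquiv.piCongrLeft_apply_apply (β := fun _ : Fin q => SpaceTime d) π.symm y (π j)
  simpa using congrFun this.symm _

/-- The average of `g` over the permutations of its `q` arguments. -/
noncomputable def symmetrization {d q : ℕ} (g : (Fin q → SpaceTime d) → ℝ)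
    (y : Fin q → SpaceTime d) : ℝ :=
  (Fintype.card (Equiv.Perm (Fin q)) : ℝ)⁻¹ * ∑ π : Equiv.Perm (Fin q), g (y ∘ π)

theorem symmetrization_comp_perm {d q : ℕ} (g : (Fin q → SpaceTime d) → ℝ)
    (y : Fin q → SpaceTime d) (π : Equiv.Perm (Fin q)) :
    symmetrization g (y ∘ π) = symmetrization g y := by
  unfold symmetrization
  congr 1
  exact Fintype.sum_equiv (Equiv.mulLeft π) _ _ fun π' => rfl

theorem eLpNorm_sub_symmetrization_le {d q : ℕ} {F g : (Fin q → SpaceTime d) → ℝ}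
    (hF : ∀ y (π : Equiv.Perm (Fin q)), F (y ∘ π) = F y)
    (hm : AEStronglyMeasurable (F - g) volume) :
    eLpNorm (F - symmetrization g) 2 volume ≤ eLpNorm (F - g) 2 volume := by
  set c := Fintype.card (Equiv.Perm (Fin q)) with hc
  have hc0 : (c : ℝ) ≠ 0 := by
    rw [hc]; exact_mod_cast Fintype.card_ne_zero
  have e1 : F - symmetrization g =
      (c : ℝ)⁻¹ • ∑ π : Equiv.Perm (Fin q), (F - g) ∘ fun y : Fin q → SpaceTime d => y ∘ π := by
    ext y
    simp only [symmetrization, Pi.sub_apply, Pi.smul_apply, Finset.sum_apply, Function.comp_apply,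
      hF, Finset.sum_sub_distrib, Finset.sum_const, Finset.card_univ, nsmul_eq_mul, smul_eq_mul,
      ← hc]
    field_simp
  rw [e1, eLpNorm_const_smul]
  have h2 : eLpNorm (∑ π : Equiv.Perm (Fin q), (F - g) ∘ fun y : Fin q → SpaceTime d => y ∘ π) 2
      volume ≤ c * eLpNorm (F - g) 2 volume := by
    refine (eLpNorm_sum_le (fun π _ => hm.comp_measurePreserving (measurePreserving_comp_perm π))
      (by norm_num)).trans (le_of_eq ?_)
    simp_rw [eLpNorm_comp_measurePreserving hm (measurePreserving_comp_perm _)]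
    simp [hc]
  calc _ ≤ ‖(c : ℝ)⁻¹‖ₑ * (c * eLpNorm (F - g) 2 volume) := by gcongr
    _ = ‖(c : ℝ)⁻¹ * c‖ₑ * eLpNorm (F - g) 2 volume := by
        rw [enorm_mul, mul_assoc, Real.enorm_natCast]
    _ = _ := by rw [inv_mul_cancel₀ hc0]; simp

/-- Elementary kernels are dense among the symmetric functions in `L²((ℝ^{d+1})^q)`: approximate by a
continuous function with compact support, symmetrize it, and sample it on a fine grid. -/
theorem exists_elementaryKernel_eLpNorm_sub_le {d q : ℕ} {F : (Fin q → SpaceTime d) → ℝ}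
    (hF : MemLp F 2) (hsymm : ∀ y (π : Equiv.Perm (Fin q)), F (y ∘ π) = F y) {ε : ℝ≥0∞}
    (hε : ε ≠ 0) : ∃ e : ElementaryKernel d q, eLpNorm (fun y => F y - e.toFun y) 2 volume ≤ ε := by
  have : IsLocallyFiniteMeasure (volume : Measure (Fin q → SpaceTime d)) := inferInstance
  have hε2 : ε / 2 ≠ 0 := by simpa using hε
  obtain ⟨g, hgs, hFg, hgc, hg2⟩ :=
      hF.exists_hasCompactSupport_eLpNorm_sub_le ENNReal.ofNat_ne_top hε2
  obtain ⟨R, hR⟩ := hgs.isCompact.isBounded.exists_norm_le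
  set s := symmetrization g with hs
  have hsc : Continuous s := by
    refine continuous_const.mul (continuous_finsetSum _ fun π _ => hgc.comp ?_)
    exact continuous_pi fun j => continuous_apply (π j)
  have hsR : ∀ y, R < ‖y‖ → s y = 0 := by
    intro y hy
    have : ∀ π : Equiv.Perm (Fin q), g (y ∘ π) = 0 := by
      intro π
      by_contra hne
      have h1 := hR _ (subset_tsupport g hne)
      have h2 : ‖y‖ ≤ ‖y ∘ π‖ := (pi_norm_le_iff_of_nonneg (norm_nonneg _)).2 fun j => by
        simpa using norm_le_pi_norm (y ∘ π) (π.symm j)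
      linarith
    simp [hs, symmetrization, this]
  have hssymm := symmetrization_comp_perm g
  have hsm : ∀ e : ElementaryKernel d q, AEStronglyMeasurable (fun y => s y - e.toFun y) volume :=
    fun e => (hsc.measurable.sub e.measurable_toFun).aestronglyMeasurable
  have hlim := tendsto_gridKernel hssymm hsc hsR
  obtain ⟨n, hn⟩ := (hlim.eventually_lt_const (u := (ε / 2) ^ 2) (by positivity)).exists
  refine ⟨gridKernel s hssymm n.succ_pos, ?_⟩
  set e := gridKernel s hssymm n.succ_pos
  have h1 : eLpNorm (fun y => s y - e.toFun y) 2 volume ≤ ε / 2 := by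
    have h2 : eLpNorm (fun y => s y - e.toFun y) 2 volume ^ 2 ≤ (ε / 2) ^ 2 := by
      refine le_trans (le_of_eq ?_) hn.le
      rw [eLpNorm_eq_lintegral_rpow_enorm_toReal two_ne_zero ENNReal.ofNat_ne_top,
        ← ENNReal.rpow_natCast, ← ENNReal.rpow_mul]
      simp [hs, e]
    exact (ENNReal.pow_le_pow_left_iff two_ne_zero).1 h2
  have h3 : (fun y => F y - e.toFun y) = (F - s) + fun y => s y - e.toFun y := by
    ext y; simp
  rw [h3]
  have h4 : AEStronglyMeasurable (F - s) volume := hF.1.sub hsc.aestronglyMeasurable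
  calc _ ≤ eLpNorm (F - s) 2 volume + eLpNorm (fun y => s y - e.toFun y) 2 volume :=
        eLpNorm_add_le h4 (hsm e) (by norm_num)
    _ ≤ ε / 2 + ε / 2 := by
        gcongr
        exact (eLpNorm_sub_symmetrization_le hsymm (hF.1.sub hg2.1)).trans hFg
    _ = ε := ENNReal.add_halves ε

/-! ### Existence and uniqueness of the multiple integral -/

section

variable {d q : ℕ} {Ω : Type*} [MeasurableSpace Ω] {P : Measure Ω} {W : Set (SpaceTime d) → Ω → ℝ}

/-- Every symmetric kernel in `L²` has a multiple Wiener–Itô integral, by completeness of `L²(Ω)`. -/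
theorem exists_isMultipleIntegral (hW : IsWhiteNoise P W) {F : (Fin q → SpaceTime d) → ℝ}
    (hF : MemLp F 2) (hsymm : ∀ y (π : Equiv.Perm (Fin q)), F (y ∘ π) = F y) :
    ∃ X, IsMultipleIntegral P W F X := by
  set K : ℝ≥0∞ := ENNReal.ofReal √((q : ℝ) ^ q) with hK
  have hKtop : K ≠ ∞ := ENNReal.ofReal_ne_top
  have hhalf : ∀ n : ℕ, ((1 / 2 : ℝ≥0∞)) ^ n ≠ 0 := fun n => by simp
  choose e he using fun n : ℕ => exists_elementaryKernel_eLpNorm_sub_le hF hsymm (hhalf n)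
  have hmono : ∀ {N n : ℕ}, N ≤ n →
      eLpNorm (fun y => F y - (e n).toFun y) 2 volume ≤ (1 / 2 : ℝ≥0∞) ^ N := fun {N n} h =>
    (he n).trans (pow_le_pow_right_of_le_one' (by simp) h)
  have hpow : Tendsto (fun n : ℕ => (1 / 2 : ℝ≥0∞) ^ n) atTop (𝓝 0) :=
    ENNReal.tendsto_pow_atTop_nhds_zero_of_lt_one (by simp)
  obtain ⟨X, hX2, hX⟩ := Lp.cauchy_complete_eLpNorm (μ := P) (p := 2) (by norm_num)
    (fun n => (e n).memLp_integral hW) (B := fun N => (K * 2 + 1) * (1 / 2 : ℝ≥0∞) ^ N)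
    (by
      rw [ENNReal.tsum_mul_left, ENNReal.tsum_geometric]
      refine ENNReal.mul_ne_top (by finiteness) ?_
      rw [one_div, ENNReal.one_sub_inv_two, inv_inv]
      exact ENNReal.ofNat_ne_top)
    (fun N n m hn hm => by
      calc _ ≤ K * (eLpNorm (fun y => F y - (e n).toFun y) 2 volume +
            eLpNorm (fun y => F y - (e m).toFun y) 2 volume) :=
            (e n).eLpNorm_integral_sub_le_add (e m) hW hF
        _ ≤ K * ((1 / 2 : ℝ≥0∞) ^ N + (1 / 2 : ℝ≥0∞) ^ N) := by
            gcongr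
            · exact hmono hn
            · exact hmono hm
        _ = K * 2 * (1 / 2 : ℝ≥0∞) ^ N := by ring
        _ < K * 2 * (1 / 2 : ℝ≥0∞) ^ N + (1 / 2 : ℝ≥0∞) ^ N :=
            ENNReal.lt_add_right (by finiteness) (hhalf N)
        _ = _ := by ring)
  refine ⟨X, hF, hX2, e, ?_, ?_⟩
  · exact tendsto_of_tendsto_of_tendsto_of_le_of_le tendsto_const_nhds hpow (fun _ => bot_le) he
  · refine hX.congr fun n => ?_
    rw [← eLpNorm_neg]
    congr 1
    ext ω
    simp

theorem isMultipleIntegral_unique (hW : IsWhiteNoise P W) {F : (Fin q → SpaceTime d) → ℝ}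
    {X Y : Ω → ℝ} (hX : IsMultipleIntegral P W F X) (hY : IsMultipleIntegral P W F Y) :
    Y =ᵐ[P] X := by
  obtain ⟨hF, hX2, e, heF, heX⟩ := hX
  obtain ⟨-, hY2, e', heF', heY⟩ := hY
  set K : ℝ≥0∞ := ENNReal.ofReal √((q : ℝ) ^ q) with hK
  have hbound : ∀ n, eLpNorm (Y - X) 2 P ≤ eLpNorm (fun ω => Y ω - (e' n).integral W ω) 2 P +
      (K * (eLpNorm (fun y => F y - (e n).toFun y) 2 volume +
        eLpNorm (fun y => F y - (e' n).toFun y) 2 volume) +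
        eLpNorm (fun ω => X ω - (e n).integral W ω) 2 P) := by
    intro n
    have hI := (e n).memLp_integral hW
    have hI' := (e' n).memLp_integral hW
    have h1 : Y - X = (fun ω => Y ω - (e' n).integral W ω) -
        ((fun ω => (e n).integral W ω - (e' n).integral W ω) + fun ω =>
            X ω - (e n).integral W ω) := by
      ext ω; simp
    rw [h1]
    refine (eLpNorm_sub_le (hY2.sub hI').1 ((hI.sub hI').add (hX2.sub hI)).1 (by norm_num)).trans
      (add_le_add_right ?_ _)
    refine (eLpNorm_add_le (hI.sub hI').1 (hX2.sub hI).1 (by norm_num)).trans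
      (add_le_add_left ?_ _)
    exact (e n).eLpNorm_integral_sub_le_add (e' n) hW hF
  have hlim : Tendsto (fun n => eLpNorm (fun ω => Y ω - (e' n).integral W ω) 2 P +
      (K * (eLpNorm (fun y => F y - (e n).toFun y) 2 volume +
        eLpNorm (fun y => F y - (e' n).toFun y) 2 volume) +
        eLpNorm (fun ω => X ω - (e n).integral W ω) 2 P)) atTop (𝓝 (0 + (K * (0 + 0) + 0))) :=
    heY.add ((ENNReal.Tendsto.const_mul (heF.add heF') (Or.inr ENNReal.ofReal_ne_top)).add heX)
  have h0 : eLpNorm (Y - X) 2 P = 0 := by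
    refine le_antisymm ?_ bot_le
    simpa using ge_of_tendsto' hlim hbound
  rw [eLpNorm_eq_zero_iff (hY2.sub hX2).1 two_ne_zero] at h0
  filter_upwards [h0] with ω hω
  exact sub_eq_zero.1 hω

end

/-! ### Moments of the random integrand -/

/-- The coefficient `σ(s,y,u(s,y))` along the random field, cut off to `0 ≤ s < t`. -/
noncomputable def diffusion {d : ℕ} {Ω : Type*} (σ : ℝ → (Fin d → ℝ) → ℝ → ℝ)
    (u : ℝ → (Fin d → ℝ) → Ω → ℝ) (t : ℝ) (ω : Ω) (a : SpaceTime d) : ℝ :=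
  if 0 ≤ a 0 ∧ a 0 < t then σ (a 0) (Fin.tail a) (u (a 0) (Fin.tail a) ω) else 0

section

variable {d : ℕ} {Ω : Type*}

theorem convIntegrand_eq_mul (ν : ℝ) (σ : ℝ → (Fin d → ℝ) → ℝ → ℝ)
    (u : ℝ → (Fin d → ℝ) → Ω → ℝ) (t : ℝ) (x : Fin d → ℝ) (ω : Ω) (a : SpaceTime d) :
    convIntegrand ν σ u t x ω a =
      heatKernel ν (t - a 0) (x - Fin.tail a) * diffusion σ u t ω a := by
  by_cases h : 0 ≤ a 0 ∧ a 0 < t <;> simp [convIntegrand, diffusion, h]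

theorem enorm_convIntegrand {ν : ℝ} (hν : 0 < ν) (σ : ℝ → (Fin d → ℝ) → ℝ → ℝ)
    (u : ℝ → (Fin d → ℝ) → Ω → ℝ) (t : ℝ) (x : Fin d → ℝ) (ω : Ω) (a : SpaceTime d) :
    ‖convIntegrand ν σ u t x ω a‖ₑ = heatWeight ν t x a * ‖diffusion σ u t ω a‖ₑ := by
  rw [convIntegrand_eq_mul, enorm_mul]
  by_cases h : 0 ≤ a 0 ∧ a 0 < t
  · have : 0 ≤ heatKernel ν (t - a 0) (x - Fin.tail a) := by
      have := sub_pos.2 h.2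
      unfold heatKernel
      positivity
    rw [heatWeight_of_mem ν x h, Real.enorm_of_nonneg this]
  · simp [diffusion, h]

theorem predictable_le_prod [mΩ : MeasurableSpace Ω] (𝓕 : Filtration ℝ≥0 mΩ) :
    𝓕.predictable ≤ (Prod.instMeasurableSpace : MeasurableSpace (ℝ≥0 × Ω)) :=
  measurableSpace_le_predictable_of_measurableSet
    (fun _ hA => (MeasurableSet.singleton _).prod (𝓕.le _ _ hA))
    (fun i _ hA => measurableSet_Ioi.prod (𝓕.le i _ hA))

theorem IsPredictableField.measurable [mΩ : MeasurableSpace Ω] {𝓕 : Filtration ℝ≥0 mΩ}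
    {u : ℝ → (Fin d → ℝ) → Ω → ℝ} (hu : IsPredictableField 𝓕 u) :
    Measurable fun p : (ℝ≥0 × Ω) × (Fin d → ℝ) => u p.1.1 p.2 p.1.2 := by
  refine Measurable.mono hu ?_ le_rfl
  exact sup_le_sup (MeasurableSpace.comap_mono (predictable_le_prod 𝓕)) le_rfl

theorem measurable_diffusion [mΩ : MeasurableSpace Ω] {𝓕 : Filtration ℝ≥0 mΩ}
    {σ : ℝ → (Fin d → ℝ) → ℝ → ℝ}
    (hσ : Measurable fun z : ℝ × (Fin d → ℝ) × ℝ => σ z.1 z.2.1 z.2.2)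
    {u : ℝ → (Fin d → ℝ) → Ω → ℝ} (hu : IsPredictableField 𝓕 u) (t : ℝ) :
    Measurable fun p : Ω × SpaceTime d => diffusion σ u t p.1 p.2 := by
  have htail : Measurable fun p : Ω × SpaceTime d => Fin.tail p.2 :=
    measurable_tail.comp measurable_snd
  have h0 : Measurable fun p : Ω × SpaceTime d => p.2 0 :=
    (measurable_pi_apply 0).comp measurable_snd
  -- predictability concerns `s ≥ 0` only; `(p.2 0).toNNReal` is `p.2 0` where nothing is cut off
  have hum : Measurable fun p : Ω × SpaceTime d => u ((p.2 0).toNNReal : ℝ) (Fin.tail p.2) p.1 :=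
    hu.measurable.comp (g := fun p : (ℝ≥0 × Ω) × (Fin d → ℝ) => u p.1.1 p.2 p.1.2)
      (f := fun p : Ω × SpaceTime d => (((p.2 0).toNNReal, p.1), Fin.tail p.2)) (by fun_prop)
  have hσm : Measurable fun p : Ω × SpaceTime d =>
      σ (p.2 0) (Fin.tail p.2) (u ((p.2 0).toNNReal : ℝ) (Fin.tail p.2) p.1) :=
    hσ.comp (h0.prodMk (htail.prodMk hum))
  have hset : MeasurableSet {p : Ω × SpaceTime d | 0 ≤ p.2 0 ∧ p.2 0 < t} :=
    measurable_snd (measurableSet_timeSlab t)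
  have e : (fun p : Ω × SpaceTime d => diffusion σ u t p.1 p.2) = fun p =>
      if 0 ≤ p.2 0 ∧ p.2 0 < t then
        σ (p.2 0) (Fin.tail p.2) (u ((p.2 0).toNNReal : ℝ) (Fin.tail p.2) p.1) else 0 := by
    ext p
    by_cases h : 0 ≤ p.2 0 ∧ p.2 0 < t
    · simp only [diffusion, h, and_self, if_true, Real.coe_toNNReal _ h.1]
    · simp only [diffusion, h, if_false]
  rw [e]
  exact Measurable.ite hset hσm measurable_const

theorem measurable_convIntegrand [MeasurableSpace Ω] {σ : ℝ → (Fin d → ℝ) → ℝ → ℝ}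
    {u : ℝ → (Fin d → ℝ) → Ω → ℝ} {t : ℝ}
    (hm : Measurable fun p : Ω × SpaceTime d => diffusion σ u t p.1 p.2) (ν : ℝ) (x : Fin d → ℝ) :
    Measurable fun p : Ω × SpaceTime d => convIntegrand ν σ u t x p.1 p.2 := by
  simp_rw [convIntegrand_eq_mul]
  refine Measurable.mul ?_ hm
  have htail : Measurable fun p : Ω × SpaceTime d => Fin.tail p.2 :=
    measurable_tail.comp measurable_snd
  exact (measurable_heatKernel ν).comp
    (f := fun p : Ω × SpaceTime d => (t - p.2 0, x - Fin.tail p.2)) (by fun_prop)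

theorem ENNReal.pow_le_one_add_rpow (r : ℝ≥0∞) {k : ℕ} {p : ℝ} (hkp : (k : ℝ) ≤ p) :
    r ^ k ≤ 1 + r ^ p := by
  rcases le_total r 1 with h | h
  · exact (pow_le_one' h k).trans le_self_add
  · rw [← ENNReal.rpow_natCast]
    exact (ENNReal.rpow_le_rpow_of_exponent_le h hkp).trans le_add_self

/-- The moments of the coefficient of order at most `p` are bounded uniformly in the point, by the
Lipschitz bound `|σ(s,y,v)| ≤ |σ(s,y,0)| + L |v|`. -/
theorem exists_lintegral_diffusion_pow_le [MeasurableSpace Ω] {P : Measure Ω}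
    [IsProbabilityMeasure P] {T t L p : ℝ} (htT : t ≤ T) (hL : 0 < L) (hp : 1 ≤ p)
    {σ : ℝ → (Fin d → ℝ) → ℝ → ℝ} {u : ℝ → (Fin d → ℝ) → Ω → ℝ}
    (hσ_lip : ∀ s ∈ Set.Icc 0 T, ∀ (y : Fin d → ℝ) (v w : ℝ),
      |σ s y v - σ s y w| ≤ L * |v - w|)
    (hσ_mom : momentSup P T p (fun s y _ => σ s y 0) < ∞) (hu_mom : momentSup P T p u < ∞) :
    ∃ C : ℝ≥0∞, C ≠ ∞ ∧ ∀ (k : ℕ), (k : ℝ) ≤ p → ∀ a : SpaceTime d,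
      ∫⁻ ω, ‖diffusion σ u t ω a‖ₑ ^ k ∂P ≤ C := by
  have hp0 : 0 ≤ p := by linarith
  set A := momentSup P T p (fun s y (_ : Ω) => σ s y 0) with hA
  set B := momentSup P T p u with hB
  refine ⟨1 + 2 ^ (p - 1) * (A + ENNReal.ofReal L ^ p * B), ?_, fun k hk a => ?_⟩
  · have h1 : (2 : ℝ≥0∞) ^ (p - 1) ≠ ∞ := ENNReal.rpow_ne_top_of_nonneg (by linarith) (by simp)
    have h2 : ENNReal.ofReal L ^ p ≠ ∞ := ENNReal.rpow_ne_top_of_nonneg hp0 (by simp)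
    have h3 := hσ_mom.ne
    have h4 := hu_mom.ne
    finiteness
  have hpow : ∀ r : ℝ, ‖r‖ₑ ^ p = ENNReal.ofReal (|r| ^ p) := fun r => by
    rw [← ENNReal.ofReal_rpow_of_nonneg (abs_nonneg r) hp0, ← Real.norm_eq_abs, ofReal_norm]
  have hle : ∀ v : ℝ → (Fin d → ℝ) → Ω → ℝ, ∀ s ∈ Set.Icc 0 T, ∀ y,
      ∫⁻ ω, ‖v s y ω‖ₑ ^ p ∂P ≤ momentSup P T p v := by
    intro v s hs y
    simp_rw [hpow]
    exact le_iSup₂_of_le s hs (le_iSup (fun y => ∫⁻ ω, ENNReal.ofReal (|v s y ω| ^ p) ∂P) y)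
  by_cases h : 0 ≤ a 0 ∧ a 0 < t
  swap
  · have hz : ∀ ω, diffusion σ u t ω a = 0 := fun ω => by simp [diffusion, h]
    simp only [hz]
    refine le_trans ?_ le_self_add
    calc _ ≤ ∫⁻ _ω, 1 ∂P := lintegral_mono fun _ => by
          simpa using pow_le_one' (zero_le_one' ℝ≥0∞) k
      _ = 1 := by simp
  have hs : a 0 ∈ Set.Icc 0 T := ⟨h.1, h.2.le.trans htT⟩
  have hpt : ∀ ω, ‖diffusion σ u t ω a‖ₑ ^ k ≤ 1 + 2 ^ (p - 1) *
      (‖σ (a 0) (Fin.tail a) 0‖ₑ ^ p + ENNReal.ofReal L ^ p * ‖u (a 0) (Fin.tail a) ω‖ₑ ^ p) := by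
    intro ω
    refine (ENNReal.pow_le_one_add_rpow _ hk).trans (add_le_add_right ?_ _)
    have h1 : ‖diffusion σ u t ω a‖ₑ ≤
        ‖σ (a 0) (Fin.tail a) 0‖ₑ + ENNReal.ofReal L * ‖u (a 0) (Fin.tail a) ω‖ₑ := by
      rw [diffusion, if_pos h]
      have h2 := hσ_lip _ hs (Fin.tail a) (u (a 0) (Fin.tail a) ω) 0
      rw [sub_zero] at h2
      rw [← ofReal_norm, ← ofReal_norm, ← ofReal_norm, ← ENNReal.ofReal_mul hL.le,
        ← ENNReal.ofReal_add (norm_nonneg _) (by positivity)]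
      refine ENNReal.ofReal_le_ofReal ?_
      simp only [Real.norm_eq_abs]
      have h3 := abs_sub_abs_le_abs_sub (σ (a 0) (Fin.tail a) (u (a 0) (Fin.tail a) ω))
        (σ (a 0) (Fin.tail a) 0)
      linarith
    calc _ ≤ (‖σ (a 0) (Fin.tail a) 0‖ₑ + ENNReal.ofReal L * ‖u (a 0) (Fin.tail a) ω‖ₑ) ^ p :=
          ENNReal.rpow_le_rpow h1 hp0
      _ ≤ 2 ^ (p - 1) * (‖σ (a 0) (Fin.tail a) 0‖ₑ ^ p +
            (ENNReal.ofReal L * ‖u (a 0) (Fin.tail a) ω‖ₑ) ^ p) :=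
          ENNReal.rpow_add_le_mul_rpow_add_rpow _ _ hp
      _ = _ := by rw [ENNReal.mul_rpow_of_nonneg _ _ hp0]
  have hc2 : (2 : ℝ≥0∞) ^ (p - 1) ≠ ∞ := ENNReal.rpow_ne_top_of_nonneg (by linarith) (by simp)
  have hcL : ENNReal.ofReal L ^ p ≠ ∞ := ENNReal.rpow_ne_top_of_nonneg hp0 (by simp)
  refine (lintegral_mono hpt).trans ?_
  rw [lintegral_add_left measurable_const, lintegral_const_mul' _ _ hc2,
    lintegral_add_left measurable_const, lintegral_const_mul' _ _ hcL]
  gcongr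
  · simp
  · exact hle (fun s y _ => σ s y 0) _ hs _
  · exact hle u _ hs _

/-- Jensen's inequality for the power `m` and a measure that is not normalized. -/
theorem lintegral_pow_le_mul {α : Type*} [MeasurableSpace α] (μ : Measure α) {h : α → ℝ≥0∞}
    (hh : AEMeasurable h μ) {m : ℕ} (hm : 1 ≤ m) :
    (∫⁻ z, h z ∂μ) ^ m ≤ (∫⁻ z, h z ^ m ∂μ) * (μ Set.univ ^ (1 - 1 / (m : ℝ))) ^ m := by
  have h1 := eLpNorm'_le_eLpNorm'_mul_rpow_measure_univ (p := 1) (q := m) zero_lt_one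
    (by exact_mod_cast hm) hh.aestronglyMeasurable
  simp only [eLpNorm', enorm_eq_self, ENNReal.rpow_one, one_div, inv_one,
      ENNReal.rpow_natCast] at h1
  refine (pow_le_pow_left' h1 m).trans (le_of_eq ?_)
  have hm0 : (m : ℝ) ≠ 0 := by positivity
  rw [mul_pow, ← ENNReal.rpow_natCast ((∫⁻ z, h z ^ m ∂μ) ^ (m : ℝ)⁻¹), ← ENNReal.rpow_mul,
    inv_mul_cancel₀ hm0, ENNReal.rpow_one, one_div]

/-- Moments of the energy of a random function `G(a) S(ω,a)`: by Jensen and Tonelli they are bounded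
by the energy of `G` and the moments of `S(a) S(b)`, hence by the moments of `S` of order `2m`. -/
theorem lintegral_energy_pow_lt_top [MeasurableSpace Ω] {P : Measure Ω} [IsProbabilityMeasure P]
    {H : Fin (d + 1) → ℝ} {G : SpaceTime d → ℝ≥0∞} (hG : Measurable G) (hE : energy H G ≠ ∞)
    {S : Ω → SpaceTime d → ℝ≥0∞} (hS : Measurable (Function.uncurry S)) {m : ℕ} (hm : 1 ≤ m)
    {C : ℝ≥0∞} (hC : C ≠ ∞) (hSC : ∀ a, ∫⁻ ω, S ω a ^ (2 * m) ∂P ≤ C) :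
    ∫⁻ ω, energy H (fun a => G a * S ω a) ^ m ∂P < ∞ := by
  -- the finite measure with density `G(a) G(b) ∏_i |a_i - b_i|^{2H_i-2}`
  set k : SpaceTime d × SpaceTime d → ℝ≥0∞ := fun z => G z.2 * G z.1 * hurstKernel H z.2 z.1 with hk
  have mk : Measurable k := by fun_prop
  set μ := ((volume : Measure (SpaceTime d)).prod (volume : Measure (SpaceTime d))).withDensity k
      with hμ
  have hμE : μ Set.univ = energy H G := by
    rw [hμ, withDensity_apply _ MeasurableSet.univ, Measure.restrict_univ,
        lintegral_prod _ (by fun_prop)]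
    rfl
  have hfin : IsFiniteMeasure μ := ⟨by rw [hμE]; exact hE.lt_top⟩
  have mS : Measurable fun p : Ω × (SpaceTime d × SpaceTime d) => S p.1 p.2.2 * S p.1 p.2.1 := by
    have h1 : Measurable fun p : Ω × (SpaceTime d × SpaceTime d) => S p.1 p.2.2 :=
      hS.comp (f := fun p : Ω × (SpaceTime d × SpaceTime d) => (p.1, p.2.2)) (by fun_prop)
    have h2 : Measurable fun p : Ω × (SpaceTime d × SpaceTime d) => S p.1 p.2.1 :=
      hS.comp (f := fun p : Ω × (SpaceTime d × SpaceTime d) => (p.1, p.2.1)) (by fun_prop)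
    exact h1.mul h2
  have mSω : ∀ ω, Measurable fun z : SpaceTime d × SpaceTime d => S ω z.2 * S ω z.1 := fun ω =>
    mS.comp (f := fun z => (ω, z)) (by fun_prop)
  have hen : ∀ ω, energy H (fun a => G a * S ω a) = ∫⁻ z, S ω z.2 * S ω z.1 ∂μ := by
    intro ω
    rw [hμ, lintegral_withDensity_eq_lintegral_mul _ mk (mSω ω), lintegral_prod _
      (mk.mul (mSω ω)).aemeasurable, energy]
    refine lintegral_congr fun b => lintegral_congr fun a => ?_
    simp only [hk, Pi.mul_apply]
    ring
  have hMtop : (μ Set.univ ^ (1 - 1 / (m : ℝ))) ^ m ≠ ∞ := by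
    refine ENNReal.pow_ne_top (ENNReal.rpow_ne_top_of_nonneg ?_ (measure_ne_top μ _))
    have : (1 : ℝ) ≤ m := by exact_mod_cast hm
    rw [sub_nonneg, div_le_one (by linarith)]
    exact this
  have hmoment : ∀ z : SpaceTime d × SpaceTime d, ∫⁻ ω, (S ω z.2 * S ω z.1) ^ m ∂P ≤ C + C := by
    intro z
    have hSz : ∀ a, Measurable fun ω => S ω a := fun a =>
      hS.comp (f := fun ω => (ω, a)) (by fun_prop)
    calc _ ≤ ∫⁻ ω, (S ω z.2 ^ (2 * m) + S ω z.1 ^ (2 * m)) ∂P := by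
          refine lintegral_mono fun ω => ?_
          rw [two_mul, pow_add, pow_add, mul_pow]
          rcases le_total (S ω z.2) (S ω z.1) with h | h
          · exact le_add_left (by gcongr)
          · exact le_add_right (by gcongr)
      _ = ∫⁻ ω, S ω z.2 ^ (2 * m) ∂P + ∫⁻ ω, S ω z.1 ^ (2 * m) ∂P :=
          lintegral_add_left ((hSz _).pow_const _) _
      _ ≤ C + C := add_le_add (hSC _) (hSC _)
  calc _ ≤ ∫⁻ ω, (∫⁻ z, (S ω z.2 * S ω z.1) ^ m ∂μ) * (μ Set.univ ^ (1 - 1 / (m : ℝ))) ^ m ∂P := by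
        refine lintegral_mono fun ω => ?_
        rw [hen ω]
        exact lintegral_pow_le_mul μ (mSω ω).aemeasurable hm
    _ = (∫⁻ z, ∫⁻ ω, (S ω z.2 * S ω z.1) ^ m ∂P ∂μ) * (μ Set.univ ^ (1 - 1 / (m : ℝ))) ^ m := by
        rw [lintegral_mul_const' _ _ hMtop, lintegral_lintegral_swap]
        exact (mS.pow_const m).aemeasurable
    _ ≤ (∫⁻ _z, (C + C) ∂μ) * (μ Set.univ ^ (1 - 1 / (m : ℝ))) ^ m := by
        gcongr with z
        exact hmoment z
    _ < ∞ := by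
        rw [lintegral_const]
        exact ENNReal.mul_lt_top (ENNReal.mul_lt_top (by finiteness) (measure_lt_top μ _))
            hMtop.lt_top

theorem measurable_energy [MeasurableSpace Ω] (H : Fin (d + 1) → ℝ) {g : Ω → SpaceTime d → ℝ≥0∞}
    (hg : Measurable (Function.uncurry g)) : Measurable fun ω => energy H (g ω) := by
  have h1 : Measurable fun p : (Ω × SpaceTime d) × SpaceTime d => g p.1.1 p.2 :=
    hg.comp (f := fun p : (Ω × SpaceTime d) × SpaceTime d => (p.1.1, p.2)) (by fun_prop)
  have h2 : Measurable fun p : (Ω × SpaceTime d) × SpaceTime d => g p.1.1 p.1.2 :=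
    hg.comp (f := fun p : (Ω × SpaceTime d) × SpaceTime d => (p.1.1, p.1.2)) (by fun_prop)
  have h3 : Measurable fun p : (Ω × SpaceTime d) × SpaceTime d =>
      g p.1.1 p.2 * g p.1.1 p.1.2 * hurstKernel H p.2 p.1.2 := by fun_prop
  exact h3.lintegral_prod_right'.lintegral_prod_right'

end

/-! ### Tensor powers -/

section

variable {d m : ℕ}

/-- `f(a) f(b)` times the covariance density. -/
noncomputable def pairDensity (H : Fin (d + 1) → ℝ) (f : SpaceTime d → ℝ)
    (z : SpaceTime d × SpaceTime d) : ℝ :=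
  f z.1 * f z.2 * covKernel H z.1 z.2

/-- Lebesgue measure on `[0,T] × ℝ^d`. -/
noncomputable def timeSlab (d : ℕ) (T : ℝ) : Measure (SpaceTime d) :=
  (volume : Measure (SpaceTime d)).restrict {a | a 0 ∈ Set.Icc 0 T}

instance (d : ℕ) (T : ℝ) : SigmaFinite (timeSlab d T) := by
  unfold timeSlab; infer_instance

theorem tensorDensity_tensorPow (H : Fin (d + 1) → ℝ) (f : SpaceTime d → ℝ)
    (w : Fin m → SpaceTime d × SpaceTime d) :
    tensorDensity H (tensorPow m f)
      (MeasurableEquiv.arrowProdEquivProdArrow (SpaceTime d) (SpaceTime d) (Fin m) w) =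
      ∏ j, pairDensity H f (w j) := by
  simp only [tensorDensity, tensorPow, pairDensity, Finset.prod_mul_distrib]
  rfl

/-- The regrouping of `(a,b)` into the pairs `(a_j,b_j)`, under which the density of `f^{⊗m}` becomes a
product. -/
theorem measurePreserving_slab (d m : ℕ) (T : ℝ) : MeasurePreserving
    (MeasurableEquiv.arrowProdEquivProdArrow (SpaceTime d) (SpaceTime d) (Fin m))
    (Measure.pi fun _ => (timeSlab d T).prod (timeSlab d T))
    ((slabMeasure d m T).prod (slabMeasure d m T)) :=
  measurePreserving_arrowProdEquivProdArrow _ _ _ (fun _ => timeSlab d T) fun _ => timeSlab d T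

/-- The squared norm of `f^{⊗m}` factorizes into the `m`-th power of the squared norm of `f`. -/
theorem tensorNormSq_tensorPow (H : Fin (d + 1) → ℝ) (T : ℝ) (f : SpaceTime d → ℝ) :
    tensorNormSq H T (tensorPow m f) =
      (∫ z, pairDensity H f z ∂(timeSlab d T).prod (timeSlab d T)) ^ m := by
  rw [tensorNormSq, ← (measurePreserving_slab d m T).integral_comp']
  simp_rw [tensorDensity_tensorPow]
  rw [integral_fintype_prod_eq_pow (pairDensity H f), Fintype.card_fin]

theorem memTensor_tensorPow {H : Fin (d + 1) → ℝ} {T : ℝ} {f : SpaceTime d → ℝ}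
    (hf : Measurable f)
    (hint : Integrable (pairDensity H f) ((timeSlab d T).prod (timeSlab d T))) :
    MemTensor H T (tensorPow m f) := by
  refine ⟨Measurable.aestronglyMeasurable ?_, ?_⟩
  · unfold tensorPow
    fun_prop
  · rw [← (measurePreserving_slab d m T).integrable_comp_emb
      (MeasurableEquiv.measurableEmbedding _)]
    have : tensorDensity H (tensorPow m f) ∘
        MeasurableEquiv.arrowProdEquivProdArrow (SpaceTime d) (SpaceTime d) (Fin m) =
        fun w => ∏ j, pairDensity H f (w j) := funext fun w => tensorDensity_tensorPow H f w
    rw [this]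
    exact Integrable.fintype_prod fun _ => hint

theorem measurable_covKernel (H : Fin (d + 1) → ℝ) :
    Measurable fun z : SpaceTime d × SpaceTime d => covKernel H z.1 z.2 := by
  unfold covKernel
  fun_prop

theorem enorm_covKernel (H : Fin (d + 1) → ℝ) (a b : SpaceTime d) :
    ‖covKernel H a b‖ₑ = ‖∏ i, H i * (2 * H i - 1)‖ₑ * hurstKernel H a b := by
  have h : ∀ i, 0 ≤ |a i - b i| ^ (2 * H i - 2) := fun i => by positivity
  rw [covKernel, enorm_mul, hurstKernel, Real.enorm_of_nonneg (Finset.prod_nonneg fun i _ => h i),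
    ENNReal.ofReal_prod_of_nonneg fun i _ => h i]

theorem lintegral_enorm_pairDensity_le (H : Fin (d + 1) → ℝ) (T : ℝ) {f : SpaceTime d → ℝ}
    (hf : Measurable f) :
    ∫⁻ z, ‖pairDensity H f z‖ₑ ∂(timeSlab d T).prod (timeSlab d T) ≤
      ‖∏ i, H i * (2 * H i - 1)‖ₑ * energy H fun a => ‖f a‖ₑ := by
  have hle : (timeSlab d T).prod (timeSlab d T) ≤
      (volume : Measure (SpaceTime d × SpaceTime d)) := by
    rw [timeSlab, Measure.prod_restrict, ← Measure.volume_eq_prod]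
    exact Measure.restrict_le_self
  have hm : Measurable fun z : SpaceTime d × SpaceTime d =>
      ‖f z.1‖ₑ * ‖f z.2‖ₑ * hurstKernel H z.1 z.2 := by fun_prop
  refine (lintegral_mono' hle le_rfl).trans ?_
  have e : ∀ z, ‖pairDensity H f z‖ₑ = ‖∏ i, H i * (2 * H i - 1)‖ₑ *
      (‖f z.1‖ₑ * ‖f z.2‖ₑ * hurstKernel H z.1 z.2) := fun z => by
    rw [pairDensity, enorm_mul, enorm_mul, enorm_covKernel]; ring
  simp_rw [e]
  rw [lintegral_const_mul _ hm, Measure.volume_eq_prod, lintegral_prod_symm' _ hm, energy]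

theorem integrable_pairDensity {H : Fin (d + 1) → ℝ} {T : ℝ} {f : SpaceTime d → ℝ}
    (hf : Measurable f) (hE : energy H (fun a => ‖f a‖ₑ) ≠ ∞) :
    Integrable (pairDensity H f) ((timeSlab d T).prod (timeSlab d T)) := by
  refine ⟨Measurable.aestronglyMeasurable ?_, ?_⟩
  · exact ((hf.comp measurable_fst).mul (hf.comp measurable_snd)).mul (measurable_covKernel H)
  · exact (lintegral_enorm_pairDensity_le H T hf).trans_lt (ENNReal.mul_lt_top (by simp) hE.lt_top)

theorem integrable_tensorNormSq {Ω : Type*} [MeasurableSpace Ω] {P : Measure Ω}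
    (H : Fin (d + 1) → ℝ) (T : ℝ) {f : Ω → SpaceTime d → ℝ}
    (hf : Measurable fun p : Ω × SpaceTime d => f p.1 p.2)
    (hE : ∫⁻ ω, energy H (fun a => ‖f ω a‖ₑ) ^ m ∂P < ∞) :
    Integrable (fun ω => tensorNormSq H T (tensorPow m (f ω))) P := by
  simp_rw [tensorNormSq_tensorPow]
  have hm : Measurable fun p : Ω × (SpaceTime d × SpaceTime d) => pairDensity H (f p.1) p.2 := by
    have h1 : Measurable fun p : Ω × (SpaceTime d × SpaceTime d) => f p.1 p.2.1 :=
      hf.comp (f := fun p : Ω × (SpaceTime d × SpaceTime d) => (p.1, p.2.1)) (by fun_prop)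
    have h2 : Measurable fun p : Ω × (SpaceTime d × SpaceTime d) => f p.1 p.2.2 :=
      hf.comp (f := fun p : Ω × (SpaceTime d × SpaceTime d) => (p.1, p.2.2)) (by fun_prop)
    exact (h1.mul h2).mul ((measurable_covKernel H).comp measurable_snd)
  refine ⟨(hm.stronglyMeasurable.integral_prod_right'.pow m).aestronglyMeasurable, ?_⟩
  set κ := ‖∏ i, H i * (2 * H i - 1)‖ₑ with hκ
  calc _ ≤ ∫⁻ ω, κ ^ m * energy H (fun a => ‖f ω a‖ₑ) ^ m ∂P := by
        refine lintegral_mono fun ω => ?_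
        have hfω : Measurable (f ω) := hf.comp (f := fun a => (ω, a)) (by fun_prop)
        rw [enorm_pow, ← mul_pow]
        gcongr
        exact (enorm_integral_le_lintegral_enorm _).trans (lintegral_enorm_pairDensity_le H T hfω)
    _ = κ ^ m * ∫⁻ ω, energy H (fun a => ‖f ω a‖ₑ) ^ m ∂P :=
        lintegral_const_mul' _ _ (by simp [hκ])
    _ < ∞ := ENNReal.mul_lt_top (by simp [hκ]) hE

end

/-! ### Skorohod duality -/

section

variable {d q : ℕ} {Ω : Type*} [MeasurableSpace Ω] {P : Measure Ω} {W : Set (SpaceTime d) → Ω → ℝ}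

/-- Malliavin derivatives of smooth cylindrical variables are square integrable: they are bounded by
a polynomial in Gaussian variables times the indicator of a bounded set. -/
theorem memLp_malliavinDeriv (hW : IsWhiteNoise P W) {n : ℕ} {A : Fin n → Set (SpaceTime d)}
    (hA : ∀ k, BddBorel (A k)) {g : (Fin n → ℝ) → ℝ} (hg : Function.HasTemperateGrowth g) :
    MemLp (malliavinDeriv q W A g) 2 (P.prod volume) := by
  have hP : IsProbabilityMeasure P := hW.gaussian.isProbabilityMeasure
  obtain ⟨hsmooth, hbd⟩ := hg
  obtain ⟨k, C, hC⟩ := hbd q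
  set U := ⋃ k, A k with hU
  have hUb : BddBorel U := BddBorel.iUnion hA
  set v : (Fin q → SpaceTime d) → Fin q → Fin n → ℝ := fun y j k => (A k).indicator 1 (y j) with hv
  have mv : Measurable v := by
    refine measurable_pi_lambda _ fun j => measurable_pi_lambda _ fun k => ?_
    exact (measurable_one.indicator (hA k).1).comp (measurable_pi_apply j)
  have mX : Measurable fun ω k => W (A k) ω :=
      measurable_pi_lambda _ fun k => hW.measurable _ (hA k)
  have hmeas : Measurable (malliavinDeriv q W A g) := by
    have hc : Continuous fun p : (Fin n → ℝ) × (Fin q → Fin n → ℝ) =>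
        iteratedFDeriv ℝ q g p.1 p.2 := by
      have h1 : Continuous (iteratedFDeriv ℝ q g) :=
          hsmooth.continuous_iteratedFDeriv (by exact_mod_cast le_top)
      exact (h1.comp continuous_fst).eval continuous_snd
    exact hc.measurable.comp (f := fun z : Ω × (Fin q → SpaceTime d) => (fun k =>
        W (A k) z.1, v z.2))
      ((mX.comp measurable_fst).prodMk (mv.comp measurable_snd))
  -- polynomial growth in `ω`, bounded support in `y`
  set B : Ω → ℝ := fun ω => C * (1 + ‖fun k => W (A k) ω‖) ^ k with hB
  set I : (Fin q → SpaceTime d) → ℝ := fun y => ∏ j, U.indicator 1 (y j) with hI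
  have hI0 : ∀ y, 0 ≤ I y := fun y => Finset.prod_nonneg fun j _ =>
    Set.indicator_nonneg (fun _ _ => zero_le_one) _
  have hle : ∀ z, ‖malliavinDeriv q W A g z‖ ≤ ‖B z.1 * I z.2‖ := by
    intro z
    have h1 : ∀ j, ‖v z.2 j‖ ≤ U.indicator 1 (z.2 j) := by
      intro j
      refine (pi_norm_le_iff_of_nonneg (Set.indicator_nonneg (fun _ _ =>
          zero_le_one) _)).2 fun k => ?_
      by_cases hk : z.2 j ∈ A k
      · have : z.2 j ∈ U := Set.mem_iUnion.2 ⟨k, hk⟩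
        simp [hv, hk, this]
      · simp only [hv, Set.indicator_of_notMem hk, norm_zero]
        exact Set.indicator_nonneg (fun _ _ => zero_le_one) _
    refine le_trans ?_ (le_abs_self _)
    calc _ ≤ ‖iteratedFDeriv ℝ q g fun k => W (A k) z.1‖ * ∏ j, ‖v z.2 j‖ :=
          ContinuousMultilinearMap.le_opNorm _ _
      _ ≤ B z.1 * I z.2 := by
          refine mul_le_mul (hC _) (Finset.prod_le_prod (fun _ _ => norm_nonneg _) fun j _ => h1 j)
            (Finset.prod_nonneg fun _ _ => norm_nonneg _) ((norm_nonneg _).trans (hC _))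
  have hB2 : MemLp B 2 P := (hW.memLp_one_add_norm_pow hA k).const_mul C
  have hI2 : Integrable (fun y => I y ^ 2) := by
    have : (fun y => I y ^ 2) = I := by
      ext y
      simp only [hI, ← Finset.prod_pow]
      refine Finset.prod_congr rfl fun j _ => ?_
      by_cases hj : y j ∈ U <;> simp [hj]
    rw [this]
    exact Integrable.fintype_prod (f := fun _ => U.indicator (1 : SpaceTime d → ℝ)) fun j =>
      (integrable_indicator_iff hUb.1).2 (integrableOn_const (C := (1 : ℝ)) hUb.volume_ne_top)
  have mI : Measurable I := Finset.measurable_prod _ fun j _ =>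
    (measurable_one.indicator hUb.1).comp (measurable_pi_apply j)
  have hBI : MemLp (fun z : Ω × (Fin q → SpaceTime d) => B z.1 * I z.2) 2 (P.prod volume) := by
    rw [memLp_two_iff_integrable_sq]
    · simp_rw [mul_pow]
      exact hB2.integrable_sq.mul_prod hI2
    · exact (hB2.1.comp_fst).mul (mI.comp measurable_snd).aestronglyMeasurable
  exact hBI.mono hmeas.aestronglyMeasurable (ae_of_all _ hle)

theorem abs_integral_mul_le_sqrt_mul_sqrt {α : Type*} [MeasurableSpace α] {μ : Measure α}
    {f g : α → ℝ} (hf : MemLp f 2 μ) (hg : MemLp g 2 μ) :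
    |∫ z, f z * g z ∂μ| ≤ √(∫ z, f z ^ 2 ∂μ) * √(∫ z, g z ^ 2 ∂μ) := by
  have h := integral_mul_norm_le_Lp_mul_Lq (μ := μ) (f := f) (g := g) Real.HolderConjugate.two_two
    (by simpa using hf) (by simpa using hg)
  simp only [Real.norm_eq_abs, Real.rpow_ofNat, sq_abs, ← Real.sqrt_eq_rpow, ← abs_mul] at h
  exact (abs_integral_le_integral_abs).trans h

/-- By Cauchy–Schwarz the norm of `F` bounds the duality pairing. -/
theorem hasSkorohodPairing_of_memLp (hW : IsWhiteNoise P W) {F : Ω × (Fin q → SpaceTime d) → ℝ}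
    (hF : MemLp F 2 (P.prod volume)) : HasSkorohodPairing P W F := by
  refine ⟨hF, √(∫ z, F z ^ 2 ∂P.prod volume), fun n A g hA hg => ?_⟩
  have hD := memLp_malliavinDeriv (q := q) hW hA hg
  exact ⟨hD, hF.integrable_mul hD, abs_integral_mul_le_sqrt_mul_sqrt hF hD⟩

end

/-! ### The stochastic convolution -/

theorem mainTheorem2 {d q : ℕ} (hd : 1 ≤ d) (hq : 1 ≤ q)
    {Ω : Type*} [MeasurableSpace Ω] (P : Measure Ω) [IsProbabilityMeasure P]
    (ν T : ℝ) (hν : 0 < ν)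
    (H : Fin (d + 1) → ℝ) (hH : ∀ i, H i ∈ Set.Ioo (1 / 2 : ℝ) 1)
    (hHurst : 2 * H 0 + ∑ i : Fin d, H i.succ > (d : ℝ) + 1 - 1 / (q : ℝ))
    (W : Set (SpaceTime d) → Ω → ℝ) (hW : IsWhiteNoise P W)
    (c : ℝ) (Z : Set (SpaceTime d) → Ω → ℝ) (hZ : IsHermiteNoise P W q H c Z)
    (σ : ℝ → (Fin d → ℝ) → ℝ → ℝ)
    (hσ_meas : Measurable (fun z : ℝ × (Fin d → ℝ) × ℝ => σ z.1 z.2.1 z.2.2))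
    (L : ℝ) (hL : 0 < L)
    (hσ_lip : ∀ s ∈ Set.Icc 0 T, ∀ (y : Fin d → ℝ) (v w : ℝ),
      |σ s y v - σ s y w| ≤ L * |v - w|)
    (p : ℝ) (hp : 2 ≤ p)
    (hσ_mom : momentSup P T p (fun s y _ => σ s y 0) < ∞)
    (u : ℝ → (Fin d → ℝ) → Ω → ℝ)
    (hu_pred : IsPredictableField (hermiteFiltration P Z hZ.measurable) u)
    (hu_mom : momentSup P T p u < ∞)
    (t : ℝ) (ht : 0 < t) (htT : t ≤ T) (x : Fin d → ℝ) :
    -- almost surely the path is in `𝓗` and its `q`-th tensor power is in `𝓗^{⊗q}`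
    (∀ᵐ ω ∂P, MemTensor H T (tensorPow 1 (convIntegrand ν σ u t x ω)) ∧
      MemTensor H T (tensorPow q (convIntegrand ν σ u t x ω))) ∧
    -- finite expected squared norm in `𝓗`
    Integrable (fun ω => tensorNormSq H T (tensorPow 1 (convIntegrand ν σ u t x ω))) P ∧
    -- finite expected squared norm in `𝓗^{⊗q}`
    (2 * (q : ℝ) ≤ p →
      Integrable (fun ω => tensorNormSq H T (tensorPow q (convIntegrand ν σ u t x ω))) P) ∧
    -- the integral of almost every path against the Hermite noise exists and is unique
    (∀ᵐ ω ∂P, ∃ X : Ω → ℝ,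
      IsHermiteIntegral P W q H c (convIntegrand ν σ u t x ω) X ∧
      ∀ Y : Ω → ℝ, IsHermiteIntegral P W q H c (convIntegrand ν σ u t x ω) Y → Y =ᵐ[P] X) ∧
    -- the integral of the random integrand exists in the sense of Skorohod duality
    HasSkorohodPairing P W (fun z : Ω × (Fin q → SpaceTime d) =>
      transferKernel q H c (convIntegrand ν σ u t x z.1) z.2) := by
  have hsum : (d : ℝ) < 2 * H 0 + ∑ i : Fin d, H i.succ := by
    have hq' : (1 : ℝ) ≤ q := by exact_mod_cast hq
    have : 1 / (q : ℝ) ≤ 1 := by rw [div_le_one (by linarith)]; exact hq'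
    linarith
  have hmeas := measurable_diffusion hσ_meas hu_pred t
  have hf := measurable_convIntegrand hmeas ν x
  have hfω : ∀ ω, Measurable (convIntegrand ν σ u t x ω) := fun ω =>
    hf.comp (f := fun a => (ω, a)) (by fun_prop)
  obtain ⟨C, hC, hmom⟩ :=
    exists_lintegral_diffusion_pow_le htT hL (by linarith) hσ_lip hσ_mom hu_mom
  have hE : ∀ m : ℕ, 1 ≤ m → 2 * (m : ℝ) ≤ p →
      ∫⁻ ω, energy H (fun a => ‖convIntegrand ν σ u t x ω a‖ₑ) ^ m ∂P < ∞ := by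
    intro m hm hmp
    simp_rw [enorm_convIntegrand hν]
    exact lintegral_energy_pow_lt_top (measurable_heatWeight ν t x)
      (lintegral_heatWeight_mul_hurstKernel_lt_top hν ht hH hsum x).ne hmeas.enorm hm hC
      fun a => hmom _ (by push_cast; exact hmp) a
  have hE1 : ∫⁻ ω, energy H (fun a => ‖convIntegrand ν σ u t x ω a‖ₑ) ∂P < ∞ := by
    simpa using hE 1 le_rfl (by simpa using hp)
  have hEm : Measurable fun ω => energy H fun a => ‖convIntegrand ν σ u t x ω a‖ₑ :=
    measurable_energy H hf.enorm
  have hEω : ∀ᵐ ω ∂P, energy H (fun a => ‖convIntegrand ν σ u t x ω a‖ₑ) ≠ ∞ :=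
    (ae_lt_top hEm hE1.ne).mono fun _ h => h.ne
  obtain ⟨K, hK, hKle⟩ := exists_lintegral_sq_transferKernel_le (q := q) hq hH c
  have hFm := measurable_transferKernel (q := q) H c (f := convIntegrand ν σ u t x) hf
  refine ⟨?_, integrable_tensorNormSq H T hf (hE 1 le_rfl (by simpa using hp)),
    fun hpq => integrable_tensorNormSq H T hf (hE q hq hpq), ?_, hasSkorohodPairing_of_memLp hW ?_⟩
  · filter_upwards [hEω] with ω hω
    have hint := integrable_pairDensity (T := T) (hfω ω) hω
    exact ⟨memTensor_tensorPow (hfω ω) hint, memTensor_tensorPow (hfω ω) hint⟩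
  · filter_upwards [hEω] with ω hω
    have hmF : Measurable (transferKernel q H c (convIntegrand ν σ u t x ω)) :=
      hFm.comp (f := fun y => (ω, y)) (by fun_prop)
    have hF2 : MemLp (transferKernel q H c (convIntegrand ν σ u t x ω)) 2 volume :=
      (memLp_two_iff_lintegral_sq hmF.aestronglyMeasurable).2
        ((hKle _ (hfω ω)).trans_lt (ENNReal.mul_lt_top hK.lt_top hω.lt_top))
    obtain ⟨X, hX⟩ := exists_isMultipleIntegral hW hF2 fun y π => transferKernel_comp_perm H c _ π y
    exact ⟨X, ⟨ae_integrable_mul_fracKernel hq hH (hfω ω) hω, hX⟩,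
      fun Y hY => isMultipleIntegral_unique hW hX hY.2⟩
  · rw [memLp_two_iff_lintegral_sq hFm.aestronglyMeasurable,
      lintegral_prod _ (hFm.enorm.pow_const 2).aemeasurable]
    calc _ ≤ ∫⁻ ω, K * energy H (fun a => ‖convIntegrand ν σ u t x ω a‖ₑ) ∂P :=
          lintegral_mono fun ω => hKle _ (hfω ω)
      _ = K * ∫⁻ ω, energy H (fun a => ‖convIntegrand ν σ u t x ω a‖ₑ) ∂P :=
          lintegral_const_mul' _ _ hK
      _ < ∞ := ENNReal.mul_lt_top hK.lt_top hE1
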